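/- Fix a compressed monoidal signature $T=(O,M,\mathrm{dom},\mathrm{cod})$, where $\mathrm{dom},\mathrm{cod}:M\to(O\times\{\mathrm{var},\mathrm{fix}\})^*$. **Definitions.** The typegraph $\mathcal G_{T!}$ has vertex set $O+M+\{!\}$ and the following edges: a loop on each $X\in O$; for each $f\in M$ and each index $i$, an edge $X\to f$ with $(X,a)=\mathrm{dom}(f)[i]$ and an edge $f\to X$ with $(X,a)=\mathrm{cod}(f)[i]$, called fixed-arity when $a=\mathrm{fix}$; and an edge from $!$ to every vertex. In a graph typed over $\mathcal G_{T!}$, vertices over $O$, $M$, $!$ are wire-vertices, node-vertices and !-vertices. $U(G)$ is $G$ without its !-vertices. $B(b)$ is the full subgraph of $G$ on the successors of a !-vertex $b$. $G\setminus K$ is the full subgraph of $G$ on the vertices not in $K$. A *!-graph* is a finite typed graph $G$ such that * in $U(G)$ every wire-vertex has at most one incoming and at most one outgoing edge, and typing restricts, at each node-vertex, to a bijection between its incident fixed-arity edges and those of its type; * the full subgraph on the !-vertices is simple and a partial order; * for each !-vertex $b$, no wire-vertex of $U(G)$ outside $U(B(b))$ is adjacent to $U(B(b))$ and no fixed-arity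 edge outside $U(B(b))$ is incident to it; * $c\in B(b)$ implies $B(c)\subseteq B(b)$ for !-vertices $b,c$. It is *concrete* if it has no !-vertices. An input (output) is a wire-vertex with no incoming (outgoing) edge in $U(G)$; inputs and outputs form the boundary. $\mathrm{In}_!(G)$ and $\mathrm{Out}_!(G)$ are the full subgraphs on the !-vertices and the inputs, respectively the outputs; $\mathrm{Bound}_!(G)$ consists of the !-vertices, the boundary, and all edges from a !-vertex to one of these. A *!-graph rewrite rule* $L\to R$ is a span of !-graphs $L\xleftarrow{i_1}I\xrightarrow{i_2}R$ such that $U(L)$, $U(R)$ have no isolated wire-vertices, together with the existence of isomorphisms $\mathrm{In}_!(L)\cong\mathrm{In}_!(R)$, $\mathrm{Out}_!(L)\cong\mathrm{Out}_!(R)$, $\mathrm{Bound}_!(L)\cong I\cong\mathrm{Bound}_!(R)$ that commute with $i_1$, $i_2$ and the inclusions. A *!-graph matching* is an injective morphism $m:L\to G$ of !-graphs such that $U(m)$ restricts, at each node-vertex, to a bijection of edge neighbourhoods, and every edge of $G$ from a !-vertex into the image of $m$ lies in the image of $m$. A *rewrite* of $G$ to $H$ by $L\to R$ is a commutative diagram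 of !-graph monomorphisms $$\begin{array}{ccccc} L & \xleftarrow{i_1} & I & \xrightarrow{i_2} & R\\ {\scriptstyle m}\downarrow & & {\scriptstyle d}\downarrow & & \downarrow{\scriptstyle r}\\ G & \xleftarrow{\ g\ } & D & \xrightarrow{\ h\ } & H\end{array}$$ whose top row is a !-graph rewrite rule and whose two squares are pushouts of typed graphs. Its *associated span* is $G\leftarrow J\to H$, where $J\subseteq D$ is the preimage of $\mathrm{Bound}_!(G)$ under $g$. The !-box operations at a !-vertex $b$ are $\mathrm{DROP}_b(G)=G\setminus b$, $\mathrm{KILL}_b(G)=G\setminus B(b)$, and $\mathrm{COPY}_b(G)$, the pushout of two copies of the inclusion $G\setminus B(b)\hookrightarrow G$, with maps $p_1,p_2:G\to\mathrm{COPY}_b(G)$. For a morphism $f:G\to H$ and $f(b)=c$, $\mathrm{OP}_c(f):\mathrm{OP}_b(G)\to\mathrm{OP}_c(H)$ denotes the unique morphism (if it exists) commuting with $f$ and the inclusions (for DROP, KILL), respectively with $f$ and both pairs $p_1,p_2$ (for COPY). If $c$ is not in the image of $f$, $\mathrm{OP}_c(f):G\to\mathrm{OP}_c(H)$ is the factorization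 of $f$ through the inclusion of $\mathrm{OP}_c(H)$ (for DROP, KILL), respectively the common value of $p_1\circ f$ and $p_2\circ f$ (for COPY). An *instance* of a span is any span obtained from it, up to isomorphism, by finitely many !-box operations, each at a !-vertex of the middle graph and applied to all three graphs and both maps; it is concrete if its graphs are. **Theorem.** Consider a rewrite as above in which $m$ is a !-graph matching. 1. Let $b$ be a !-vertex of $G$. There is a unique vertex $b_D$ of $D$ with $g(b_D)=b$, and if $b$ is in the image of $m$ there is a unique vertex $b_I$ of $I$ with $m(i_1(b_I))=b$. Let $\mathrm{OP}$ be any of COPY, DROP, KILL, and apply it at $b$ in $G$, at $b_D$ in $D$, at $h(b_D)$ in $H$ and, if $b$ is in the image of $m$, at $b_I$, $i_1(b_I)$, $i_2(b_I)$ in $I$, $L$, $R$. * If $b$ is not in the image of $m$, then the maps $\mathrm{OP}(m),\mathrm{OP}(d),\mathrm{OP}(r),\mathrm{OP}(g),\mathrm{OP}(h)$ exist, $\mathrm{OP}(m)$ is a !-graph matching, and the diagram with top row $L\xleftarrow{i_1} I\xrightarrow{i_2} R$ and bottom row $\mathrm{OP}(G)\leftarrow\mathrm{OP}(D)\to\mathrm{OP}(H)$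 is a rewrite. * If $b$ is in the image of $m$, then the maps $\mathrm{OP}(i_1),\mathrm{OP}(i_2),\mathrm{OP}(m),\mathrm{OP}(d),\mathrm{OP}(r),\mathrm{OP}(g),\mathrm{OP}(h)$ exist, $\mathrm{OP}(m)$ is a !-graph matching, and the diagram with top row $\mathrm{OP}(L)\leftarrow\mathrm{OP}(I)\to\mathrm{OP}(R)$ and bottom row $\mathrm{OP}(G)\leftarrow\mathrm{OP}(D)\to\mathrm{OP}(H)$ is a rewrite. 2. Suppose that $U(G)$ has no isolated wire-vertices. Then the associated span $G\leftarrow J\to H$ is a !-graph rewrite rule, and for every concrete instance $G'\leftarrow J'\to H'$ of it there is a concrete instance $L'\to R'$ of $L\to R$ and a rewrite of $G'$ to $H'$ by $L'\to R'$ at a !-graph matching $L'\to G'$, whose associated span is a (concrete) instance of $G\leftarrow J\to H$ and is isomorphic to $G'\leftarrow J'\to H'$ by an isomorphism that is the identity on $G'$ and $H'$. -/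

import Mathlib

open CategoryTheory

universe u v w

namespace BangGraph

/-! Compressed monoidal signatures and the derived compressed !-typegraph -/

/-- Tag of an entry of a compressed (co)domain: variable arity or fixed (single) arity. -/
inductive Arity : Type
  | variable
  | fixed

/-- A compressed monoidal signature `(O, M, dom, cod)`. -/
structure Signature : Type (w + 1) where
  O : Type w
  M : Type w
  dom : M → List (O × Arity)
  cod : M → List (O × Arity)

/-- A directed multigraph: a functor from the category `E ⇉ V` to sets. -/
structure DGraph : Type (u + 1) where
  V : Type u
  E : Type u
  src : E → V
  tgt : E → V

/-- Graph morphisms. -/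
@[ext]
structure DGraph.Hom (G : DGraph.{u}) (H : DGraph.{v}) : Type (max u v) where
  onV : G.V → H.V
  onE : G.E → H.E
  src_onE : ∀ e, H.src (onE e) = onV (G.src e)
  tgt_onE : ∀ e, H.tgt (onE e) = onV (G.tgt e)

/-- Vertices of the !-typegraph of `T`: the objects, the morphisms, and the vertex `!`. -/
inductive TypeVertex (T : Signature.{w}) : Type w
  | obj (X : T.O)
  | mor (f : T.M)
  | bang

/-- Edges of the !-typegraph of `T`: `mid_X`, `in_{f,i}`, `out_{f,i}`, and an edge `p_v` from `!`
to every vertex `v`, the vertex `!` included. -/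
inductive TypeEdge (T : Signature.{w}) : Type w
  | mid (X : T.O)
  | inp (f : T.M) (i : Fin (T.dom f).length)
  | out (f : T.M) (i : Fin (T.cod f).length)
  | box (x : TypeVertex T)

def TypeEdge.src {T : Signature.{w}} : TypeEdge T → TypeVertex T
  | .mid X => .obj X
  | .inp f i => .obj ((T.dom f).get i).1
  | .out f _ => .mor f
  | .box _ => .bang

def TypeEdge.tgt {T : Signature.{w}} : TypeEdge T → TypeVertex T
  | .mid X => .obj X
  | .inp f _ => .mor f
  | .out f i => .obj ((T.cod f).get i).1
  | .box x => x

/-- The fixed-arity edges of the typegraph. -/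
def TypeEdge.IsFixed {T : Signature.{w}} : TypeEdge T → Prop
  | .mid _ => False
  | .inp f i => ((T.dom f).get i).2 = Arity.fixed
  | .out f i => ((T.cod f).get i).2 = Arity.fixed
  | .box _ => False

/-- The derived compressed !-typegraph of `T`. -/
def typegraph (T : Signature.{w}) : DGraph.{w} where
  V := TypeVertex T
  E := TypeEdge T
  src := TypeEdge.src
  tgt := TypeEdge.tgt

/-! The category of graphs typed over the !-typegraph (the slice category) -/

/-- A graph together with a typing morphism to the !-typegraph of `T`. -/
structure TypedGraph (T : Signature.{w}) extends DGraph.{u} where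
  typ : DGraph.Hom toDGraph (typegraph T)

variable {T : Signature.{w}}

/-- Morphisms of typed graphs: graph morphisms commuting with the typing morphisms. -/
@[ext]
structure TypedGraph.Hom (G H : TypedGraph.{u} T) extends
    DGraph.Hom G.toDGraph H.toDGraph where
  typ_onV : ∀ x, H.typ.onV (onV x) = G.typ.onV x
  typ_onE : ∀ e, H.typ.onE (onE e) = G.typ.onE e

instance : Category (TypedGraph.{u} T) where
  Hom := TypedGraph.Hom
  id G :=
    { onV := id, onE := id, src_onE := fun _ => rfl, tgt_onE := fun _ => rfl,
      typ_onV := fun _ => rfl, typ_onE := fun _ => rfl }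
  comp f g :=
    { onV := g.onV ∘ f.onV
      onE := g.onE ∘ f.onE
      src_onE := fun e => by simp [g.src_onE, f.src_onE]
      tgt_onE := fun e => by simp [g.tgt_onE, f.tgt_onE]
      typ_onV := fun x => by simp [g.typ_onV, f.typ_onV]
      typ_onE := fun e => by simp [g.typ_onE, f.typ_onE] }

/-- Injectivity on vertices and on edges; these are the monomorphisms. -/
def IsMono {G H : TypedGraph.{u} T} (f : G ⟶ H) : Prop :=
  Function.Injective f.onV ∧ Function.Injective f.onE

namespace TypedGraph

variable (G : TypedGraph.{u} T)

def IsBang (x : G.V) : Prop := G.typ.onV x = TypeVertex.bang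

def IsWire (x : G.V) : Prop := ∃ X, G.typ.onV x = TypeVertex.obj X

def IsNode (x : G.V) : Prop := ∃ f, G.typ.onV x = TypeVertex.mor f

/-- `e` is an edge of `U(G)`, the graph obtained from `G` by dropping all !-vertices. (No edge goes
from a wire- or node-vertex to a !-vertex, so it suffices to look at the source.) -/
def IsCore (e : G.E) : Prop := ¬ G.IsBang (G.src e)

def IsFixed (e : G.E) : Prop := TypeEdge.IsFixed (G.typ.onE e)

def Incident (e : G.E) (x : G.V) : Prop := G.src e = x ∨ G.tgt e = x

/-- `U(G)` is a string graph: the typing morphism is arity-matching (it restricts to a bijection from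
the fixed edge neighbourhood of each node-vertex to that of its type), and each wire-vertex has at
most one incoming and at most one outgoing edge in `U(G)`. -/
structure CoreIsString : Prop where
  arity : ∀ x, G.IsNode x →
    Set.BijOn G.typ.onE {e | G.IsFixed e ∧ G.Incident e x}
      {t : TypeEdge T | t.IsFixed ∧ (t.src = G.typ.onV x ∨ t.tgt = G.typ.onV x)}
  wire_in : ∀ e₁ e₂, G.IsCore e₁ → G.IsCore e₂ → G.IsWire (G.tgt e₁) →
    G.tgt e₁ = G.tgt e₂ → e₁ = e₂
  wire_out : ∀ e₁ e₂, G.IsCore e₁ → G.IsCore e₂ → G.IsWire (G.src e₁) →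
    G.src e₁ = G.src e₂ → e₁ = e₂

/-- The vertex set of the !-box `B(b)`: all successors of `b`. The !-box itself is the full
subgraph on this set. -/
def box (b : G.V) : Set G.V := {x | ∃ e, G.src e = b ∧ G.tgt e = x}

/-- The full subgraph of `U(G)` on the wire- and node-vertices of `S` is open in `U(G)`: it is not
adjacent to any wire-vertex (outside it), nor incident to any fixed-arity edge (outside it). -/
structure CoreIsOpen (S : Set G.V) : Prop where
  not_wire_tgt : ∀ e, G.IsCore e → G.src e ∈ S → G.tgt e ∉ S → ¬ G.IsWire (G.tgt e)
  not_wire_src : ∀ e, G.IsCore e → G.tgt e ∈ S → G.src e ∉ S → ¬ G.IsWire (G.src e)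
  not_fixed : ∀ e, G.IsCore e → G.IsFixed e → (G.src e ∈ S ↔ G.tgt e ∈ S)

/-- The full subgraph `β(G)` on the !-vertices is posetal: simple, and a partial order. -/
structure BangPosetal : Prop where
  simple : ∀ e₁ e₂, G.IsBang (G.src e₁) → G.IsBang (G.tgt e₁) →
    G.src e₁ = G.src e₂ → G.tgt e₁ = G.tgt e₂ → e₁ = e₂
  refl : ∀ b, G.IsBang b → b ∈ G.box b
  antisymm : ∀ b c, G.IsBang b → G.IsBang c → c ∈ G.box b → b ∈ G.box c → b = c
  trans : ∀ a b c, G.IsBang a → G.IsBang b → G.IsBang c →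
    b ∈ G.box a → c ∈ G.box b → c ∈ G.box a

/-- (Finite) !-graphs. -/
structure IsBangGraph : Prop where
  finite_V : Finite G.V
  finite_E : Finite G.E
  string : G.CoreIsString
  posetal : G.BangPosetal
  box_open : ∀ b, G.IsBang b → G.CoreIsOpen (G.box b)
  nested : ∀ b c, G.IsBang b → G.IsBang c → c ∈ G.box b → G.box c ⊆ G.box b

/-- Concrete graphs have no !-vertices. -/
def IsConcrete : Prop := ∀ x, ¬ G.IsBang x

/-- Inputs of `U(G)`. -/
def IsInput (x : G.V) : Prop := G.IsWire x ∧ ∀ e, G.IsCore e → G.tgt e ≠ x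

/-- Outputs of `U(G)`. -/
def IsOutput (x : G.V) : Prop := G.IsWire x ∧ ∀ e, G.IsCore e → G.src e ≠ x

/-- `U(G)` has no isolated wire-vertices. -/
def NoIsolatedWires : Prop := ∀ x, G.IsWire x → ∃ e, G.IsCore e ∧ G.Incident e x

/-! Subgraphs -/

/-- Subgraphs of a typed graph. -/
structure Subgraph where
  verts : Set G.V
  edges : Set G.E
  src_mem : ∀ e ∈ edges, G.src e ∈ verts
  tgt_mem : ∀ e ∈ edges, G.tgt e ∈ verts

variable {G}

/-- A subgraph as a typed graph. -/
def Subgraph.graph (K : G.Subgraph) : TypedGraph.{u} T where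
  V := K.verts
  E := K.edges
  src e := ⟨G.src e.1, K.src_mem e.1 e.2⟩
  tgt e := ⟨G.tgt e.1, K.tgt_mem e.1 e.2⟩
  typ :=
    { onV := fun x => G.typ.onV x.1
      onE := fun e => G.typ.onE e.1
      src_onE := fun e => G.typ.src_onE e.1
      tgt_onE := fun e => G.typ.tgt_onE e.1 }

/-- The inclusion of a subgraph. -/
def Subgraph.incl (K : G.Subgraph) : K.graph ⟶ G where
  onV := Subtype.val
  onE := Subtype.val
  src_onE _ := rfl
  tgt_onE _ := rfl
  typ_onV _ := rfl
  typ_onE _ := rfl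

/-- The inclusion between two nested subgraphs. -/
def Subgraph.inclOfLE {K K' : G.Subgraph} (hV : K.verts ⊆ K'.verts) (hE : K.edges ⊆ K'.edges) :
    K.graph ⟶ K'.graph where
  onV x := ⟨x.1, hV x.2⟩
  onE e := ⟨e.1, hE e.2⟩
  src_onE _ := rfl
  tgt_onE _ := rfl
  typ_onV _ := rfl
  typ_onE _ := rfl

/-- The preimage of a subgraph under a morphism. -/
def Subgraph.comap {H : TypedGraph.{u} T} (f : G ⟶ H) (K : H.Subgraph) : G.Subgraph where
  verts := {x | f.onV x ∈ K.verts}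
  edges := {e | f.onE e ∈ K.edges}
  src_mem e he := by
    have := K.src_mem _ he
    rwa [f.src_onE] at this
  tgt_mem e he := by
    have := K.tgt_mem _ he
    rwa [f.tgt_onE] at this

variable (G)

/-- The full subgraph on a set of vertices. -/
def full (S : Set G.V) : G.Subgraph where
  verts := S
  edges := {e | G.src e ∈ S ∧ G.tgt e ∈ S}
  src_mem _ he := he.1
  tgt_mem _ he := he.2

/-- `In_!(G)`: the full subgraph on the !-vertices and the inputs of `U(G)`. -/
def inB : G.Subgraph := G.full {x | G.IsBang x ∨ G.IsInput x}

/-- `Out_!(G)`: the full subgraph on the !-vertices and the outputs of `U(G)`. -/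
def outB : G.Subgraph := G.full {x | G.IsBang x ∨ G.IsOutput x}

/-- `Bound_!(G)`: the !-vertices and the boundary of `U(G)`, with all edges from a !-vertex to a
!-vertex or to a boundary vertex. -/
def boundB : G.Subgraph where
  verts := {x | G.IsBang x ∨ G.IsInput x ∨ G.IsOutput x}
  edges := {e | G.IsBang (G.src e) ∧
    (G.IsBang (G.tgt e) ∨ G.IsInput (G.tgt e) ∨ G.IsOutput (G.tgt e))}
  src_mem _ he := Or.inl he.1
  tgt_mem _ he := he.2

variable {G} in
theorem isBang_src_of_tgt {e : G.E} (h : G.IsBang (G.tgt e)) : G.IsBang (G.src e) := by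
  have hs := G.typ.src_onE e
  have ht := G.typ.tgt_onE e
  unfold IsBang at *
  rw [h] at ht
  rw [← hs]
  revert ht
  change (TypeEdge.tgt (G.typ.onE e) = _) → TypeEdge.src (G.typ.onE e) = _
  cases G.typ.onE e <;> simp [TypeEdge.src, TypeEdge.tgt]

/-- The inclusion of `In_!(G)` into `Bound_!(G)`. -/
def inToBound : G.inB.graph ⟶ G.boundB.graph :=
  Subgraph.inclOfLE (fun _ h => h.imp_right Or.inl) (by
    rintro e ⟨hs, ht⟩
    refine ⟨?_, ht.imp_right Or.inl⟩
    by_contra hb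
    rcases ht with ht | ht
    · exact hb (isBang_src_of_tgt ht)
    · exact ht.2 e hb rfl)

/-- The inclusion of `Out_!(G)` into `Bound_!(G)`. -/
def outToBound : G.outB.graph ⟶ G.boundB.graph :=
  Subgraph.inclOfLE (fun _ h => h.imp_right Or.inr) (by
    rintro e ⟨hs, ht⟩
    refine ⟨?_, ht.imp_right Or.inr⟩
    by_contra hb
    rcases hs with hs | hs
    · exact hb hs
    · exact hs.2 e hb rfl)

/-! The !-box operations on graphs -/

/-- `G ∖ b`, with its inclusion into `G` as `(G.dropSub b).incl`. -/
def dropSub (b : G.V) : G.Subgraph := G.full {x | x ≠ b}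

/-- `G ∖ B(b)`, with its inclusion into `G` as `(G.killSub b).incl`. -/
def killSub (b : G.V) : G.Subgraph := G.full {x | x ∉ G.box b}

/-- The edges that do not lie in `G ∖ B(b)`. -/
def touching (b : G.V) : Set G.E := {e | G.src e ∈ G.box b ∨ G.tgt e ∈ G.box b}

open Classical in
/-- The vertex `x` in the copy of `G` with index `k` inside `COPY_b(G)`. -/
noncomputable def copyV (b : G.V) (k : Bool) (x : G.V) :
    {y : G.V × Bool // y.2 = true → y.1 ∈ G.box b} :=
  ⟨(x, if x ∈ G.box b then k else false), by
    by_cases h : x ∈ G.box b <;> simp [h]⟩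

open Classical in
/-- The edge `e` in the copy of `G` with index `k` inside `COPY_b(G)`. -/
noncomputable def copyE (b : G.V) (k : Bool) (e : G.E) :
    {y : G.E × Bool // y.2 = true → y.1 ∈ G.touching b} :=
  ⟨(e, if e ∈ G.touching b then k else false), by
    by_cases h : e ∈ G.touching b <;> simp [h]⟩

/-- `COPY_b(G)`: two copies of `G` glued along `G ∖ B(b)`. Vertices and edges outside `G ∖ B(b)`
are tagged by `false` or `true`, those in `G ∖ B(b)` by `false` only. -/
noncomputable def copy (b : G.V) : TypedGraph.{u} T where
  V := {y : G.V × Bool // y.2 = true → y.1 ∈ G.box b}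
  E := {y : G.E × Bool // y.2 = true → y.1 ∈ G.touching b}
  src e := G.copyV b e.1.2 (G.src e.1.1)
  tgt e := G.copyV b e.1.2 (G.tgt e.1.1)
  typ :=
    { onV := fun x => G.typ.onV x.1.1
      onE := fun e => G.typ.onE e.1.1
      src_onE := fun e => G.typ.src_onE e.1.1
      tgt_onE := fun e => G.typ.tgt_onE e.1.1 }

/-- The two maps `G ⟶ COPY_b(G)`. -/
noncomputable def copyMap (b : G.V) (k : Bool) : G ⟶ G.copy b where
  onV := G.copyV b k
  onE := G.copyE b k
  src_onE e := by
    by_cases h : e ∈ G.touching b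
    · simp [copy, copyE, h]
    · have h' : G.src e ∉ G.box b := fun hh => h (Or.inl hh)
      simp [copy, copyE, copyV, h, h']
  tgt_onE e := by
    by_cases h : e ∈ G.touching b
    · simp [copy, copyE, h]
    · have h' : G.tgt e ∉ G.box b := fun hh => h (Or.inr hh)
      simp [copy, copyE, copyV, h, h']
  typ_onV _ := rfl
  typ_onE _ := rfl

end TypedGraph

/-- The defining property of `COPY_b(G)`: it is the pushout of two copies of the inclusion of
`G ∖ B(b)` into `G`. -/
theorem copy_isPushout (G : TypedGraph.{u} T) (b : G.V) :
    IsPushout (G.killSub b).incl (G.killSub b).incl (G.copyMap b false) (G.copyMap b true) := by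
  have nt : ∀ e : G.E, e ∉ G.touching b ↔ G.src e ∉ G.box b ∧ G.tgt e ∉ G.box b := by
    intro e; simp [TypedGraph.touching]
  have hw : (G.killSub b).incl ≫ G.copyMap b false = (G.killSub b).incl ≫ G.copyMap b true := by
    apply TypedGraph.Hom.ext
    · funext x
      have hx : x.1 ∉ G.box b := x.2
      change G.copyV b false x.1 = G.copyV b true x.1
      simp [TypedGraph.copyV, hx]
    · funext e
      have he : e.1 ∉ G.touching b := (nt e.1).2 e.2
      change G.copyE b false e.1 = G.copyE b true e.1
      simp [TypedGraph.copyE, he]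
  have hcV : ∀ (x : G.V) (k : Bool) (hk : k = true → x ∈ G.box b),
      G.copyV b k x = ⟨(x, k), hk⟩ := by
    intro x k hk
    by_cases hx : x ∈ G.box b
    · simp [TypedGraph.copyV, hx]
    · have : k = false := by simpa using fun h => hx (hk h)
      subst this; simp [TypedGraph.copyV]
  have hcE : ∀ (x : G.E) (k : Bool) (hk : k = true → x ∈ G.touching b),
      G.copyE b k x = ⟨(x, k), hk⟩ := by
    intro x k hk
    by_cases hx : x ∈ G.touching b
    · simp [TypedGraph.copyE, hx]
    · have : k = false := by simpa using fun h => hx (hk h)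
      subst this; simp [TypedGraph.copyE]
  refine ⟨⟨hw⟩, ⟨Limits.PushoutCocone.IsColimit.mk _
    (fun s => ?_) (fun s => ?_) (fun s => ?_) (fun s m h1 h2 => ?_)⟩⟩
  · have hV : ∀ x, x ∉ G.box b → s.inl.onV x = s.inr.onV x := fun x hx =>
      congrFun (congrArg (fun f : (G.killSub b).graph ⟶ s.pt => f.onV) s.condition) ⟨x, hx⟩
    have key : ∀ (k : Bool) (x : G.V),
        (if (G.copyV b k x).1.2 then s.inr else s.inl).onV x =
          (if k then s.inr else s.inl).onV x := by
      intro k x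
      by_cases hx : x ∈ G.box b
      · simp [TypedGraph.copyV, hx]
      · cases k <;> simp [TypedGraph.copyV, hx, hV x hx]
    exact
      { onV := fun x => (if x.1.2 then s.inr else s.inl).onV x.1.1
        onE := fun e => (if e.1.2 then s.inr else s.inl).onE e.1.1
        src_onE := fun e => by
          rw [TypedGraph.Hom.toHom, DGraph.Hom.src_onE]
          exact (key e.1.2 _).symm
        tgt_onE := fun e => by
          rw [TypedGraph.Hom.toHom, DGraph.Hom.tgt_onE]
          exact (key e.1.2 _).symm
        typ_onV := fun x => TypedGraph.Hom.typ_onV _ _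
        typ_onE := fun e => TypedGraph.Hom.typ_onE _ _ }
  · apply TypedGraph.Hom.ext
    · funext x
      change (if (G.copyV b false x).1.2 then s.inr else s.inl).onV x = s.inl.onV x
      simp [TypedGraph.copyV]
    · funext x
      change (if (G.copyE b false x).1.2 then s.inr else s.inl).onE x = s.inl.onE x
      simp [TypedGraph.copyE]
  · apply TypedGraph.Hom.ext
    · funext x
      change (if (G.copyV b true x).1.2 then s.inr else s.inl).onV x = s.inr.onV x
      by_cases hx : x ∈ G.box b
      · simp [TypedGraph.copyV, hx]
      · have this : s.inl.onV x = s.inr.onV x := congrFun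
          (congrArg (fun f : (G.killSub b).graph ⟶ s.pt => f.onV) s.condition) ⟨x, hx⟩
        simpa [TypedGraph.copyV, hx] using this
    · funext x
      change (if (G.copyE b true x).1.2 then s.inr else s.inl).onE x = s.inr.onE x
      by_cases hx : x ∈ G.touching b
      · simp [TypedGraph.copyE, hx]
      · have this : s.inl.onE x = s.inr.onE x := congrFun
          (congrArg (fun f : (G.killSub b).graph ⟶ s.pt => f.onE) s.condition) ⟨x, (nt x).1 hx⟩
        simpa [TypedGraph.copyE, hx] using this
  · apply TypedGraph.Hom.ext
    · funext ⟨⟨x, k⟩, hk⟩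
      change m.onV _ = (if k then s.inr else s.inl).onV x
      rw [← hcV x k hk]
      cases k
      · exact congrFun (congrArg (fun f : G ⟶ s.pt => f.onV) h1) x
      · exact congrFun (congrArg (fun f : G ⟶ s.pt => f.onV) h2) x
    · funext ⟨⟨x, k⟩, hk⟩
      change m.onE _ = (if k then s.inr else s.inl).onE x
      rw [← hcE x k hk]
      cases k
      · exact congrFun (congrArg (fun f : G ⟶ s.pt => f.onE) h1) x
      · exact congrFun (congrArg (fun f : G ⟶ s.pt => f.onE) h2) x

/-- The three !-box operations. -/
inductive BoxOp : Type
  | COPY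
  | DROP
  | KILL

/-- The graph `OP_b(G)`. -/
noncomputable def BoxOp.obj (op : BoxOp) (G : TypedGraph.{u} T) (b : G.V) : TypedGraph.{u} T :=
  match op with
  | .COPY => G.copy b
  | .DROP => (G.dropSub b).graph
  | .KILL => (G.killSub b).graph

/-! The !-box operations on morphisms -/

/-- For `f : G ⟶ H` with `f b = c`, the morphism `f' : OP_b(G) ⟶ OP_c(H)` is `OP_c(f)`, that is,
it commutes with `f` through the inclusions `DROP ⟶ id`, `KILL ⟶ id`, respectively through both
maps `id ⟶ COPY`. This determines `f'`. -/
def IsOpMap {G H : TypedGraph.{u} T} (f : G ⟶ H) (b : G.V) (c : H.V) : (op : BoxOp) →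
    (op.obj G b ⟶ op.obj H c) → Prop
  | .COPY => fun f' => f.onV b = c ∧
      ∀ k, G.copyMap b k ≫ (show G.copy b ⟶ H.copy c from f') = f ≫ H.copyMap c k
  | .DROP => fun f' => f.onV b = c ∧
      (show (G.dropSub b).graph ⟶ (H.dropSub c).graph from f') ≫ (H.dropSub c).incl =
        (G.dropSub b).incl ≫ f
  | .KILL => fun f' => f.onV b = c ∧
      (show (G.killSub b).graph ⟶ (H.killSub c).graph from f') ≫ (H.killSub c).incl =
        (G.killSub b).incl ≫ f

/-- For `f : G ⟶ H` and `c` not in the image of `f`, the morphism `f' : G ⟶ OP_c(H)` is `OP_c(f)`,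
that is, it is the factorization of `f` through `DROP_c(H)` or `KILL_c(H)`, respectively the composite
of `f` with either map to `COPY_c(H)`. This determines `f'`. -/
def IsOpMapOutside {G H : TypedGraph.{u} T} (f : G ⟶ H) (c : H.V) : (op : BoxOp) →
    (G ⟶ op.obj H c) → Prop
  | .COPY => fun f' => c ∉ Set.range f.onV ∧
      ∀ k, (show G ⟶ H.copy c from f') = f ≫ H.copyMap c k
  | .DROP => fun f' => c ∉ Set.range f.onV ∧
      (show G ⟶ (H.dropSub c).graph from f') ≫ (H.dropSub c).incl = f
  | .KILL => fun f' => c ∉ Set.range f.onV ∧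
      (show G ⟶ (H.killSub c).graph from f') ≫ (H.killSub c).incl = f

/-! Rewrite rules -/

/-- A span `L ⟵ I ⟶ R` of typed graphs. -/
structure RuleSpan (T : Signature.{w}) where
  L : TypedGraph.{u} T
  I : TypedGraph.{u} T
  R : TypedGraph.{u} T
  i₁ : I ⟶ L
  i₂ : I ⟶ R

namespace RuleSpan

/-- The span is a !-graph rewrite rule (a directed !-graph equation). -/
structure IsRule (S : RuleSpan.{u} T) : Prop where
  bang_L : S.L.IsBangGraph
  bang_I : S.I.IsBangGraph
  bang_R : S.R.IsBangGraph
  noIsolated_L : S.L.NoIsolatedWires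
  noIsolated_R : S.R.NoIsolatedWires
  boundary : ∃ (φI : S.L.inB.graph ≅ S.R.inB.graph) (φO : S.L.outB.graph ≅ S.R.outB.graph)
    (φL : S.L.boundB.graph ≅ S.I) (φR : S.R.boundB.graph ≅ S.I),
    (S.L.inToBound ≫ φL.hom) ≫ S.i₁ = S.L.inB.incl ∧
    (S.L.outToBound ≫ φL.hom) ≫ S.i₁ = S.L.outB.incl ∧
    (S.R.inToBound ≫ φR.hom) ≫ S.i₂ = S.R.inB.incl ∧
    (S.R.outToBound ≫ φR.hom) ≫ S.i₂ = S.R.outB.incl ∧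
    φI.hom ≫ (S.R.inToBound ≫ φR.hom) = S.L.inToBound ≫ φL.hom ∧
    φO.hom ≫ (S.R.outToBound ≫ φR.hom) = S.L.outToBound ≫ φL.hom

/-- All three graphs of the span are concrete. -/
def IsConcrete (S : RuleSpan.{u} T) : Prop := S.L.IsConcrete ∧ S.I.IsConcrete ∧ S.R.IsConcrete

/-- One step of an instantiation of spans: a !-box operation at a !-vertex of `I`, performed on all
three graphs and on both legs, or an isomorphism of spans. -/
inductive Step : RuleSpan.{u} T → RuleSpan.{u} T → Prop
  | op (S : RuleSpan.{u} T) (op : BoxOp) (b : S.I.V) (hb : S.I.IsBang b)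
      (j₁ : op.obj S.I b ⟶ op.obj S.L (S.i₁.onV b))
      (j₂ : op.obj S.I b ⟶ op.obj S.R (S.i₂.onV b))
      (h₁ : IsOpMap S.i₁ b (S.i₁.onV b) op j₁) (h₂ : IsOpMap S.i₂ b (S.i₂.onV b) op j₂) :
      Step S ⟨op.obj S.L (S.i₁.onV b), op.obj S.I b, op.obj S.R (S.i₂.onV b), j₁, j₂⟩
  | iso (S S' : RuleSpan.{u} T) (a : S.L ≅ S'.L) (c : S.I ≅ S'.I) (e : S.R ≅ S'.R)
      (h₁ : c.hom ≫ S'.i₁ = S.i₁ ≫ a.hom) (h₂ : c.hom ≫ S'.i₂ = S.i₂ ≫ e.hom) : Step S S'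

/-- `S.HasInstance S'`: the span `S'` is an instance of `S`, i.e. it can be obtained from `S`, up to
isomorphism, by zero or more !-box operations. -/
def HasInstance (S S' : RuleSpan.{u} T) : Prop := Relation.ReflTransGen Step S S'

end RuleSpan

/-! Matchings and double pushout rewrites -/

/-- `f` reflects !-box containment: every edge from a !-vertex into the image of `f` is in the image
of `f`. -/
def ReflectsBox {G H : TypedGraph.{u} T} (f : G ⟶ H) : Prop :=
  ∀ e : H.E, H.IsBang (H.src e) → H.tgt e ∈ Set.range f.onV → e ∈ Set.range f.onE

/-- `U(f)` is a local isomorphism: it restricts to a bijection from the edge neighbourhood of each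
node-vertex in `U(G)` to the edge neighbourhood of its image in `U(H)`. -/
def CoreLocalIso {G H : TypedGraph.{u} T} (f : G ⟶ H) : Prop :=
  ∀ x, G.IsNode x → Set.BijOn f.onE {e | G.IsCore e ∧ G.Incident e x}
    {e | H.IsCore e ∧ H.Incident e (f.onV x)}

/-- !-graph matchings. -/
structure IsMatching {L G : TypedGraph.{u} T} (m : L ⟶ G) : Prop where
  bang_L : L.IsBangGraph
  bang_G : G.IsBangGraph
  mono : IsMono m
  localIso : CoreLocalIso m
  reflects : ReflectsBox m

/-- The data of a double pushout diagram with top span `L ⟵ I ⟶ R` and bottom span `G ⟵ D ⟶ H`. -/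
structure DPO (S : RuleSpan.{u} T) (G D H : TypedGraph.{u} T) where
  m : S.L ⟶ G
  d : S.I ⟶ D
  r : S.R ⟶ H
  g : D ⟶ G
  h : D ⟶ H

namespace DPO

variable {S : RuleSpan.{u} T} {G D H : TypedGraph.{u} T}

/-- The diagram is a rewrite: the top span is a !-graph rewrite rule, the bottom row consists of
!-graphs, the maps are monomorphisms, and both squares are pushouts of typed graphs. -/
structure IsRewrite (P : DPO S G D H) : Prop where
  rule : S.IsRule
  bang_G : G.IsBangGraph
  bang_D : D.IsBangGraph
  bang_H : H.IsBangGraph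
  mono_m : IsMono P.m
  mono_d : IsMono P.d
  mono_r : IsMono P.r
  mono_g : IsMono P.g
  mono_h : IsMono P.h
  left : IsPushout S.i₁ P.d P.m P.g
  right : IsPushout S.i₂ P.d P.r P.h

/-- The associated span `G ⟵ J ⟶ H`, where `J` is the preimage of `Bound_!(G)` in `D`. -/
def associated (P : DPO S G D H) : RuleSpan.{u} T where
  L := G
  I := (G.boundB.comap P.g).graph
  R := H
  i₁ := (G.boundB.comap P.g).incl ≫ P.g
  i₂ := (G.boundB.comap P.g).incl ≫ P.h

/-- `P'` arises from `P` by applying `OP_b` to the bottom row only. -/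
structure IsOpOutside (P : DPO S G D H) (op : BoxOp) (b : G.V) (bD : D.V) (bH : H.V)
    (P' : DPO S (op.obj G b) (op.obj D bD) (op.obj H bH)) : Prop where
  m : IsOpMapOutside P.m b op P'.m
  d : IsOpMapOutside P.d bD op P'.d
  r : IsOpMapOutside P.r bH op P'.r
  g : IsOpMap P.g bD b op P'.g
  h : IsOpMap P.h bD bH op P'.h

/-- `P'` arises from `P` by applying `OP_b` to the whole diagram; its top span is
`OP_b(L) ⟵ OP_b(I) ⟶ OP_b(R)`. -/
structure IsOpInside (P : DPO S G D H) (op : BoxOp) (bL : S.L.V) (bI : S.I.V) (bR : S.R.V)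
    (b : G.V) (bD : D.V) (bH : H.V)
    (j₁ : op.obj S.I bI ⟶ op.obj S.L bL) (j₂ : op.obj S.I bI ⟶ op.obj S.R bR)
    (P' : DPO ⟨op.obj S.L bL, op.obj S.I bI, op.obj S.R bR, j₁, j₂⟩
      (op.obj G b) (op.obj D bD) (op.obj H bH)) : Prop where
  i₁ : IsOpMap S.i₁ bI bL op j₁
  i₂ : IsOpMap S.i₂ bI bR op j₂
  m : IsOpMap P.m bL b op P'.m
  d : IsOpMap P.d bI bD op P'.d
  r : IsOpMap P.r bR bH op P'.r
  g : IsOpMap P.g bD b op P'.g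
  h : IsOpMap P.h bD bH op P'.h

end DPO

end BangGraph

open BangGraph

/-!
Every !-box operation comes with a projection `OP_b(G) ⟶ G` (the inclusion for DROP and KILL, the
folding of the two copies for COPY). If a monomorphism `f` reflects !-box containment, then `OP(f)`
exists (`exists_isOpMap`, `exists_isOpMapOutside`). It is the base change of `f` along these
projections (`IsOpMap.isBaseChange`) or, if the !-vertex lies outside the image of `f`, along the
identity and the projection (`IsOpMapOutside.isBaseChange`). A pushout square of monomorphisms in
typed graphs is a commutative square of jointly surjective maps whose images meet in the image of
the corner (`IsGluing.of_isPushout`, `IsGluing.isPushout`), and this description is stable under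
base change (`IsGluing.baseChange`).

A rewrite rule is a span `L ⟵ I ⟶ R` whose legs are, up to isomorphism, the inclusions of the
boundary graphs, with matching inputs and outputs (`RuleSpan.IsRule.isBoundarySpan`,
`IsBoundarySpan.boundary`). Since the open !-boxes do not cut wires, the projections lift the edges
at wire-vertices (`liftsWireEdges_proj`), so that boundaries pull back to boundaries and rules to
rules. The legs of a rule reflect !-box containment because their images contain all edges from
!-vertices to the boundary, and this passes along pushouts from the rule and the matching to all
maps of a rewrite. Hence a !-box operation takes rewrites to rewrites
(`DPO.IsRewrite.exists_isOpOutside`, `DPO.IsRewrite.exists_isOpInside`).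

For the associated span, a boundary vertex of `G` never disappears inside `L`, and an input of `G`
that comes from `I` stays an input in `H`, since the boundary vertices of `L` and `R` have the same
kind (`IsBoundarySpan.isInput_of_gluing`). Its middle graph is cut out of `D` by the boundary of
`G`, so forming the associated span commutes with !-box operations (`DPO.IsAssociatedVia.op`). An
instance of the associated span is therefore obtained by applying each operation of the given chain
to the whole rewrite (`DPO.IsRewrite.isRewriteOfInstance`).
-/

namespace BangGraph

variable {T : Signature.{w}}

/-! ### Morphisms of typed graphs -/

@[simp]
theorem comp_onV {A B C : TypedGraph.{u} T} (f : A ⟶ B) (g : B ⟶ C) (x : A.V) :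
    (f ≫ g).onV x = g.onV (f.onV x) := rfl

@[simp]
theorem comp_onE {A B C : TypedGraph.{u} T} (f : A ⟶ B) (g : B ⟶ C) (e : A.E) :
    (f ≫ g).onE e = g.onE (f.onE e) := rfl

theorem hom_ext {A B : TypedGraph.{u} T} {f g : A ⟶ B} (hV : ∀ x, f.onV x = g.onV x)
    (hE : ∀ e, f.onE e = g.onE e) : f = g :=
  TypedGraph.Hom.ext (funext hV) (funext hE)

theorem congr_onV {A B : TypedGraph.{u} T} {f g : A ⟶ B} (h : f = g) (x : A.V) :
    f.onV x = g.onV x := by rw [h]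

theorem congr_onE {A B : TypedGraph.{u} T} {f g : A ⟶ B} (h : f = g) (e : A.E) :
    f.onE e = g.onE e := by rw [h]

section Map

variable {A B C : TypedGraph.{u} T} (f : A ⟶ B)

theorem isBang_map (x : A.V) : B.IsBang (f.onV x) ↔ A.IsBang x := by
  unfold TypedGraph.IsBang; rw [f.typ_onV]

theorem isWire_map (x : A.V) : B.IsWire (f.onV x) ↔ A.IsWire x := by
  unfold TypedGraph.IsWire; rw [f.typ_onV]

theorem isNode_map (x : A.V) : B.IsNode (f.onV x) ↔ A.IsNode x := by
  unfold TypedGraph.IsNode; rw [f.typ_onV]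

theorem isCore_map (e : A.E) : B.IsCore (f.onE e) ↔ A.IsCore e := by
  unfold TypedGraph.IsCore; rw [f.src_onE, isBang_map]

theorem isFixed_map (e : A.E) : B.IsFixed (f.onE e) ↔ A.IsFixed e := by
  unfold TypedGraph.IsFixed; rw [f.typ_onE]

variable {f}

theorem incident_map {e : A.E} {x : A.V} (h : A.Incident e x) :
    B.Incident (f.onE e) (f.onV x) := by
  unfold TypedGraph.Incident at *
  rw [f.src_onE, f.tgt_onE]
  exact h.imp (congrArg _) (congrArg _)

theorem IsMono.incident_iff (hf : IsMono f) {e : A.E} {x : A.V} :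
    B.Incident (f.onE e) (f.onV x) ↔ A.Incident e x := by
  unfold TypedGraph.Incident
  rw [f.src_onE, f.tgt_onE, hf.1.eq_iff, hf.1.eq_iff]

theorem IsMono.comp {g : B ⟶ C} (hf : IsMono f) (hg : IsMono g) : IsMono (f ≫ g) :=
  ⟨hg.1.comp hf.1, hg.2.comp hf.2⟩

theorem IsMono.of_comp {g : B ⟶ C} (h : IsMono (f ≫ g)) : IsMono f :=
  ⟨Function.Injective.of_comp (f := g.onV) h.1, Function.Injective.of_comp (f := g.onE) h.2⟩

theorem IsMono.cancel {g : B ⟶ C} (hg : IsMono g) {f₁ f₂ : A ⟶ B} (h : f₁ ≫ g = f₂ ≫ g) :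
    f₁ = f₂ :=
  hom_ext (fun x => hg.1 (congr_onV h x)) (fun e => hg.2 (congr_onE h e))

theorem isMono_id (A : TypedGraph.{u} T) : IsMono (𝟙 A) :=
  ⟨Function.injective_id, Function.injective_id⟩

theorem isMono_iso (a : A ≅ B) : IsMono a.hom :=
  IsMono.of_comp (g := a.inv) (by rw [a.hom_inv_id]; exact isMono_id A)

theorem iso_surjective_onV (a : A ≅ B) : Function.Surjective a.hom.onV := fun y =>
  ⟨a.inv.onV y, congr_onV a.inv_hom_id y⟩

theorem iso_surjective_onE (a : A ≅ B) : Function.Surjective a.hom.onE := fun y =>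
  ⟨a.inv.onE y, congr_onE a.inv_hom_id y⟩

theorem TypedGraph.Subgraph.isMono_incl (K : A.Subgraph) : IsMono K.incl :=
  ⟨Subtype.val_injective, Subtype.val_injective⟩

/-- The factorization of a morphism through a subgraph that contains its image. -/
def TypedGraph.Subgraph.lift (K : B.Subgraph) (f : A ⟶ B) (hV : ∀ x, f.onV x ∈ K.verts)
    (hE : ∀ e, f.onE e ∈ K.edges) : A ⟶ K.graph where
  onV x := ⟨f.onV x, hV x⟩
  onE e := ⟨f.onE e, hE e⟩
  src_onE e := Subtype.ext (f.src_onE e)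
  tgt_onE e := Subtype.ext (f.tgt_onE e)
  typ_onV := f.typ_onV
  typ_onE := f.typ_onE

theorem TypedGraph.Subgraph.lift_incl (K : B.Subgraph) (f : A ⟶ B)
    (hV : ∀ x, f.onV x ∈ K.verts) (hE : ∀ e, f.onE e ∈ K.edges) :
    K.lift f hV hE ≫ K.incl = f := rfl

/-- A morphism that is bijective on vertices and on edges is an isomorphism. -/
noncomputable def isoOfBijective (f : A ⟶ B) (hV : Function.Bijective f.onV)
    (hE : Function.Bijective f.onE) : A ≅ B where
  hom := f
  inv :=
    { onV := (Equiv.ofBijective _ hV).symm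
      onE := (Equiv.ofBijective _ hE).symm
      src_onE := fun e => hV.1 (by
        rw [← f.src_onE]
        exact (congrArg B.src ((Equiv.ofBijective _ hE).apply_symm_apply e)).trans
          ((Equiv.ofBijective _ hV).apply_symm_apply (B.src e)).symm)
      tgt_onE := fun e => hV.1 (by
        rw [← f.tgt_onE]
        exact (congrArg B.tgt ((Equiv.ofBijective _ hE).apply_symm_apply e)).trans
          ((Equiv.ofBijective _ hV).apply_symm_apply (B.tgt e)).symm)
      typ_onV := fun x => by
        rw [← f.typ_onV]
        exact congrArg B.typ.onV ((Equiv.ofBijective _ hV).apply_symm_apply x)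
      typ_onE := fun e => by
        rw [← f.typ_onE]
        exact congrArg B.typ.onE ((Equiv.ofBijective _ hE).apply_symm_apply e) }
  hom_inv_id := hom_ext (fun x => (Equiv.ofBijective _ hV).symm_apply_apply x)
    (fun e => (Equiv.ofBijective _ hE).symm_apply_apply e)
  inv_hom_id := hom_ext (fun x => (Equiv.ofBijective _ hV).apply_symm_apply x)
    (fun e => (Equiv.ofBijective _ hE).apply_symm_apply e)

/-- Two subobjects of `B` with the same image are isomorphic over `B`. -/
theorem IsMono.exists_iso (hf : IsMono f) (K : B.Subgraph) (hV : Set.range f.onV = K.verts)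
    (hE : Set.range f.onE = K.edges) : ∃ φ : K.graph ≅ A, φ.hom ≫ f = K.incl := by
  let l : A ⟶ K.graph := K.lift f (fun x => hV ▸ ⟨x, rfl⟩) (fun e => hE ▸ ⟨e, rfl⟩)
  have hlV : Function.Bijective l.onV := by
    refine ⟨fun x y h => hf.1 (congrArg Subtype.val h), ?_⟩
    rintro ⟨y, hy⟩
    obtain ⟨x, rfl⟩ := hV.symm ▸ hy
    exact ⟨x, rfl⟩
  have hlE : Function.Bijective l.onE := by
    refine ⟨fun x y h => hf.2 (congrArg Subtype.val h), ?_⟩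
    rintro ⟨y, hy⟩
    obtain ⟨x, rfl⟩ := hE.symm ▸ hy
    exact ⟨x, rfl⟩
  refine ⟨(isoOfBijective l hlV hlE).symm, ?_⟩
  rw [← K.lift_incl f (fun x => hV ▸ ⟨x, rfl⟩) (fun e => hE ▸ ⟨e, rfl⟩)]
  exact (isoOfBijective l hlV hlE).inv_hom_id_assoc _

end Map

/-! ### Pushouts of monomorphisms -/

/-- The square with legs `i`, `d` and `m`, `g` is commutative, `m` and `g` are jointly surjective,
and their images meet only in the image of the corner. -/
structure IsGluing {I L D G : TypedGraph.{u} T} (i : I ⟶ L) (d : I ⟶ D) (m : L ⟶ G)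
    (g : D ⟶ G) : Prop where
  comm : i ≫ m = d ≫ g
  coverV : ∀ x, x ∈ Set.range m.onV ∨ x ∈ Set.range g.onV
  coverE : ∀ e, e ∈ Set.range m.onE ∨ e ∈ Set.range g.onE
  meetV : ∀ y x, m.onV y = g.onV x → ∃ z, i.onV z = y ∧ d.onV z = x
  meetE : ∀ y x, m.onE y = g.onE x → ∃ z, i.onE z = y ∧ d.onE z = x

section Gluing

variable {I L D G : TypedGraph.{u} T} {i : I ⟶ L} {d : I ⟶ D} {m : L ⟶ G} {g : D ⟶ G}

theorem IsGluing.commV (h : IsGluing i d m g) (z : I.V) :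
    m.onV (i.onV z) = g.onV (d.onV z) := congr_onV h.comm z

theorem IsGluing.commE (h : IsGluing i d m g) (z : I.E) :
    m.onE (i.onE z) = g.onE (d.onE z) := congr_onE h.comm z

theorem IsGluing.flip (h : IsGluing i d m g) : IsGluing d i g m where
  comm := h.comm.symm
  coverV x := (h.coverV x).symm
  coverE x := (h.coverE x).symm
  meetV y x hyx := (h.meetV x y hyx.symm).imp fun _ => And.symm
  meetE y x hyx := (h.meetE x y hyx.symm).imp fun _ => And.symm

/-- The graph `G` with a free truth value attached to each vertex and each edge: maps into it are
maps to `G` with an arbitrary pair of predicates on vertices and on edges. The second and third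
components of an edge are the truth values at its source and target. -/
def withPred (G : TypedGraph.{u} T) : TypedGraph.{u} T where
  V := G.V × Prop
  E := G.E × Prop × Prop × Prop
  src e := (G.src e.1, e.2.1)
  tgt e := (G.tgt e.1, e.2.2.1)
  typ :=
    { onV := fun x => G.typ.onV x.1
      onE := fun e => G.typ.onE e.1
      src_onE := fun e => G.typ.src_onE e.1
      tgt_onE := fun e => G.typ.tgt_onE e.1 }

/-- The map to `withPred G` given by a map to `G` and predicates `p`, `q`. -/
def homWithPred (m : L ⟶ G) (p : L.V → Prop) (q : L.E → Prop) : L ⟶ withPred G where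
  onV x := (m.onV x, p x)
  onE e := (m.onE e, p (L.src e), p (L.tgt e), q e)
  src_onE e := Prod.ext (m.src_onE e) rfl
  tgt_onE e := Prod.ext (m.tgt_onE e) rfl
  typ_onV x := m.typ_onV x
  typ_onE e := m.typ_onE e

/-- The union of the images of `m` and `g`. -/
def unionRange (m : L ⟶ G) (g : D ⟶ G) : G.Subgraph where
  verts := Set.range m.onV ∪ Set.range g.onV
  edges := Set.range m.onE ∪ Set.range g.onE
  src_mem := by
    rintro _ (⟨e, rfl⟩ | ⟨e, rfl⟩)
    · exact Or.inl ⟨_, (m.src_onE e).symm⟩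
    · exact Or.inr ⟨_, (g.src_onE e).symm⟩
  tgt_mem := by
    rintro _ (⟨e, rfl⟩ | ⟨e, rfl⟩)
    · exact Or.inl ⟨_, (m.tgt_onE e).symm⟩
    · exact Or.inr ⟨_, (g.tgt_onE e).symm⟩

theorem IsGluing.of_isPushout (h : IsPushout i d m g) (hg : IsMono g) : IsGluing i d m g := by
  -- A retraction of `G` onto the union of the images shows joint surjectivity.
  let K := unionRange m g
  let a : L ⟶ K.graph := K.lift m (fun x => Or.inl ⟨x, rfl⟩) (fun x => Or.inl ⟨x, rfl⟩)
  let b : D ⟶ K.graph := K.lift g (fun x => Or.inr ⟨x, rfl⟩) (fun x => Or.inr ⟨x, rfl⟩)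
  have hab : i ≫ a = d ≫ b := K.isMono_incl.cancel h.w
  have hret : h.desc a b hab ≫ K.incl = 𝟙 G := by
    apply h.hom_ext
    · rw [h.inl_desc_assoc]; rfl
    · rw [h.inr_desc_assoc]; rfl
  -- The predicate "lies in the image of `i`" on `L` and the true predicate on `D` agree on `I`,
  -- so they extend to `G`.
  let a' := homWithPred m (· ∈ Set.range i.onV) (· ∈ Set.range i.onE)
  let b' := homWithPred g (fun _ => True) (fun _ => True)
  have hab' : i ≫ a' = d ≫ b' :=
    hom_ext (fun x => Prod.ext (congr_onV h.w x) (by simp [a', b', homWithPred]))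
      (fun x => Prod.ext (congr_onE h.w x) (by
        have hs : L.src (i.onE x) ∈ Set.range i.onV := ⟨_, (i.src_onE x).symm⟩
        have ht : L.tgt (i.onE x) ∈ Set.range i.onV := ⟨_, (i.tgt_onE x).symm⟩
        exact Prod.ext (eq_true hs) (Prod.ext (eq_true ht) (eq_true ⟨x, rfl⟩))))
  have h1 := h.inl_desc a' b' hab'
  have h2 := h.inr_desc a' b' hab'
  refine ⟨h.w, fun x => ?_, fun x => ?_, fun y x hyx => ?_, fun y x hyx => ?_⟩
  · rw [← show _ = x from congr_onV hret x]
    exact ((h.desc a b hab).onV x).2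
  · rw [← show _ = x from congr_onE hret x]
    exact ((h.desc a b hab).onE x).2
  · have e1 := congr_onV h1 y
    have e2 := congr_onV h2 x
    rw [comp_onV] at e1 e2
    rw [hyx, e2] at e1
    obtain ⟨z, rfl⟩ : y ∈ Set.range i.onV := of_eq_true (congrArg Prod.snd e1).symm
    exact ⟨z, rfl, hg.1 ((congr_onV h.w z).symm.trans hyx)⟩
  · have e1 := congr_onE h1 y
    have e2 := congr_onE h2 x
    rw [comp_onE] at e1 e2
    rw [hyx, e2] at e1
    obtain ⟨z, rfl⟩ : y ∈ Set.range i.onE :=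
      of_eq_true (congrArg (fun t => t.2.2.2) e1).symm
    exact ⟨z, rfl, hg.2 ((congr_onE h.w z).symm.trans hyx)⟩

theorem IsGluing.hom_ext (h : IsGluing i d m g) {X : TypedGraph.{u} T} {k k' : G ⟶ X}
    (h1 : m ≫ k = m ≫ k') (h2 : g ≫ k = g ≫ k') : k = k' := by
  refine BangGraph.hom_ext (fun x => ?_) (fun e => ?_)
  · rcases h.coverV x with ⟨y, rfl⟩ | ⟨y, rfl⟩
    · exact congr_onV h1 y
    · exact congr_onV h2 y
  · rcases h.coverE e with ⟨y, rfl⟩ | ⟨y, rfl⟩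
    · exact congr_onE h1 y
    · exact congr_onE h2 y

theorem IsGluing.exists_desc (h : IsGluing i d m g) (hm : IsMono m) (hg : IsMono g)
    {X : TypedGraph.{u} T} (a : L ⟶ X) (b : D ⟶ X) (hab : i ≫ a = d ≫ b) :
    ∃ k : G ⟶ X, m ≫ k = a ∧ g ≫ k = b := by
  have hV : ∀ x, ∃ v, (∀ y, m.onV y = x → a.onV y = v) ∧ ∀ w, g.onV w = x → b.onV w = v := by
    intro x
    rcases h.coverV x with ⟨y, rfl⟩ | ⟨w, rfl⟩
    · refine ⟨a.onV y, fun y' hy => by rw [hm.1 hy], fun w hw => ?_⟩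
      obtain ⟨z, rfl, rfl⟩ := h.meetV y w hw.symm
      exact (congr_onV hab z).symm
    · refine ⟨b.onV w, fun y hy => ?_, fun y' hy => by rw [hg.1 hy]⟩
      obtain ⟨z, rfl, rfl⟩ := h.meetV y w hy
      exact congr_onV hab z
  have hE : ∀ x, ∃ v, (∀ y, m.onE y = x → a.onE y = v) ∧ ∀ w, g.onE w = x → b.onE w = v := by
    intro x
    rcases h.coverE x with ⟨y, rfl⟩ | ⟨w, rfl⟩
    · refine ⟨a.onE y, fun y' hy => by rw [hm.2 hy], fun w hw => ?_⟩
      obtain ⟨z, rfl, rfl⟩ := h.meetE y w hw.symm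
      exact (congr_onE hab z).symm
    · refine ⟨b.onE w, fun y hy => ?_, fun y' hy => by rw [hg.2 hy]⟩
      obtain ⟨z, rfl, rfl⟩ := h.meetE y w hy
      exact congr_onE hab z
  choose φ hφm hφg using hV
  choose ψ hψm hψg using hE
  let k : G ⟶ X :=
    { onV := φ
      onE := ψ
      src_onE := fun e => by
        rcases h.coverE e with ⟨y, rfl⟩ | ⟨y, rfl⟩
        · rw [← hψm _ y rfl, ← hφm _ _ (m.src_onE y).symm]
          exact a.src_onE y
        · rw [← hψg _ y rfl, ← hφg _ _ (g.src_onE y).symm]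
          exact b.src_onE y
      tgt_onE := fun e => by
        rcases h.coverE e with ⟨y, rfl⟩ | ⟨y, rfl⟩
        · rw [← hψm _ y rfl, ← hφm _ _ (m.tgt_onE y).symm]
          exact a.tgt_onE y
        · rw [← hψg _ y rfl, ← hφg _ _ (g.tgt_onE y).symm]
          exact b.tgt_onE y
      typ_onV := fun x => by
        rcases h.coverV x with ⟨y, rfl⟩ | ⟨y, rfl⟩
        · rw [← hφm _ y rfl, m.typ_onV, a.typ_onV]
        · rw [← hφg _ y rfl, g.typ_onV, b.typ_onV]
      typ_onE := fun x => by
        rcases h.coverE x with ⟨y, rfl⟩ | ⟨y, rfl⟩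
        · rw [← hψm _ y rfl, m.typ_onE, a.typ_onE]
        · rw [← hψg _ y rfl, g.typ_onE, b.typ_onE] }
  exact ⟨k, BangGraph.hom_ext (fun y => (hφm _ y rfl).symm) (fun y => (hψm _ y rfl).symm),
    BangGraph.hom_ext (fun y => (hφg _ y rfl).symm) (fun y => (hψg _ y rfl).symm)⟩

theorem IsGluing.isPushout (h : IsGluing i d m g) (hm : IsMono m) (hg : IsMono g) :
    IsPushout i d m g :=
  ⟨⟨h.comm⟩, ⟨Limits.PushoutCocone.IsColimit.mk _
    (fun s => (h.exists_desc hm hg s.inl s.inr s.condition).choose)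
    (fun s => (h.exists_desc hm hg s.inl s.inr s.condition).choose_spec.1)
    (fun s => (h.exists_desc hm hg s.inl s.inr s.condition).choose_spec.2)
    (fun s _ h1 h2 =>
      have hs := (h.exists_desc hm hg s.inl s.inr s.condition).choose_spec
      h.hom_ext (h1.trans hs.1.symm) (h2.trans hs.2.symm))⟩⟩

end Gluing

/-! ### !-graphs under monomorphisms and under COPY -/

theorem TypedGraph.isCore_of_isFixed {A : TypedGraph.{u} T} {e : A.E} (h : A.IsFixed e) :
    A.IsCore e := by
  intro hb
  have hs := A.typ.src_onE e
  unfold TypedGraph.IsBang at hb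
  unfold TypedGraph.IsFixed at h
  rw [hb] at hs
  change TypeEdge.src (A.typ.onE e) = _ at hs
  revert hs h
  cases A.typ.onE e <;> simp [TypeEdge.src, TypeEdge.IsFixed]

theorem TypedGraph.IsWire.not_isBang {A : TypedGraph.{u} T} {x : A.V} (h : A.IsWire x) :
    ¬ A.IsBang x := by
  obtain ⟨X, hX⟩ := h
  unfold TypedGraph.IsBang
  rw [hX]
  exact fun h => nomatch h

theorem TypedGraph.IsNode.not_isBang {A : TypedGraph.{u} T} {x : A.V} (h : A.IsNode x) :
    ¬ A.IsBang x := by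
  obtain ⟨X, hX⟩ := h
  unfold TypedGraph.IsBang
  rw [hX]
  exact fun h => nomatch h

theorem TypedGraph.IsWire.not_isNode {A : TypedGraph.{u} T} {x : A.V} (h : A.IsWire x) :
    ¬ A.IsNode x := by
  obtain ⟨X, hX⟩ := h
  rintro ⟨f, hf⟩
  exact nomatch hX.symm.trans hf

theorem mem_box_map {A B : TypedGraph.{u} T} (f : A ⟶ B) {b x : A.V} (h : x ∈ A.box b) :
    f.onV x ∈ B.box (f.onV b) := by
  obtain ⟨e, rfl, rfl⟩ := h
  exact ⟨f.onE e, f.src_onE e, f.tgt_onE e⟩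

/-- A graph is a !-graph if it embeds into a !-graph so that the image is full with respect to
edges that leave a !-vertex and contains all fixed-arity edges at its node-vertices. This covers
isomorphic copies, the graphs `G ∖ b` and `G ∖ B(b)`, and boundary graphs. -/
theorem IsMono.isBangGraph {A B : TypedGraph.{u} T} {f : A ⟶ B} (hf : IsMono f)
    (hB : B.IsBangGraph)
    (hbox : ∀ e, B.IsBang (B.src e) → B.src e ∈ Set.range f.onV → B.tgt e ∈ Set.range f.onV →
      e ∈ Set.range f.onE)
    (hfix : ∀ x, A.IsNode x → ∀ e, B.IsFixed e → B.Incident e (f.onV x) →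
      e ∈ Set.range f.onE) : A.IsBangGraph := by
  have hmem : ∀ b x, A.IsBang b → (f.onV x ∈ B.box (f.onV b) ↔ x ∈ A.box b) := by
    refine fun b x hb => ⟨?_, mem_box_map f⟩
    rintro ⟨e, hs, ht⟩
    obtain ⟨e, rfl⟩ := hbox e (by rwa [hs, isBang_map]) ⟨_, hs.symm⟩ ⟨_, ht.symm⟩
    rw [f.src_onE] at hs
    rw [f.tgt_onE] at ht
    exact ⟨e, hf.1 hs, hf.1 ht⟩
  refine
    { finite_V := ?_, finite_E := ?_, string := ⟨?_, ?_, ?_⟩, posetal := ⟨?_, ?_, ?_, ?_⟩,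
      box_open := ?_, nested := ?_ }
  · have := hB.finite_V
    exact Finite.of_injective _ hf.1
  · have := hB.finite_E
    exact Finite.of_injective _ hf.2
  · intro x hx
    have H := hB.string.arity (f.onV x) ((isNode_map f x).2 hx)
    rw [f.typ_onV] at H
    refine ⟨?_, ?_, ?_⟩
    · intro e he
      rw [← f.typ_onE]
      exact H.mapsTo ⟨(isFixed_map f e).2 he.1, incident_map he.2⟩
    · intro e₁ h₁ e₂ h₂ h
      rw [← f.typ_onE, ← f.typ_onE] at h
      exact hf.2 (H.injOn ⟨(isFixed_map f _).2 h₁.1, incident_map h₁.2⟩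
        ⟨(isFixed_map f _).2 h₂.1, incident_map h₂.2⟩ h)
    · intro t ht
      obtain ⟨e, he, rfl⟩ := H.surjOn ht
      obtain ⟨e, rfl⟩ := hfix x hx e he.1 he.2
      exact ⟨e, ⟨(isFixed_map f _).1 he.1, hf.incident_iff.1 he.2⟩, (f.typ_onE e).symm⟩
  · intro e₁ e₂ h₁ h₂ hw h
    refine hf.2 (hB.string.wire_in _ _ ((isCore_map f _).2 h₁) ((isCore_map f _).2 h₂) ?_ ?_)
    · rwa [f.tgt_onE, isWire_map]
    · rw [f.tgt_onE, f.tgt_onE, h]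
  · intro e₁ e₂ h₁ h₂ hw h
    refine hf.2 (hB.string.wire_out _ _ ((isCore_map f _).2 h₁) ((isCore_map f _).2 h₂) ?_ ?_)
    · rwa [f.src_onE, isWire_map]
    · rw [f.src_onE, f.src_onE, h]
  · intro e₁ e₂ h₁ h₂ hs ht
    refine hf.2 (hB.posetal.simple _ _ ?_ ?_ ?_ ?_)
    · rwa [f.src_onE, isBang_map]
    · rwa [f.tgt_onE, isBang_map]
    · rw [f.src_onE, f.src_onE, hs]
    · rw [f.tgt_onE, f.tgt_onE, ht]
  · exact fun b hb => (hmem b b hb).1 (hB.posetal.refl _ ((isBang_map f b).2 hb))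
  · exact fun b c hb hc h₁ h₂ => hf.1 (hB.posetal.antisymm _ _ ((isBang_map f b).2 hb)
      ((isBang_map f c).2 hc) (mem_box_map f h₁) (mem_box_map f h₂))
  · exact fun a b c ha hb hc h₁ h₂ => (hmem a c ha).1 (hB.posetal.trans _ _ _
      ((isBang_map f a).2 ha) ((isBang_map f b).2 hb) ((isBang_map f c).2 hc)
      (mem_box_map f h₁) (mem_box_map f h₂))
  · intro b hb
    have H := hB.box_open _ ((isBang_map f b).2 hb)
    refine ⟨fun e he hs ht => ?_, fun e he ht hs => ?_, fun e he hfe => ?_⟩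
    · rw [← isWire_map f, ← f.tgt_onE]
      refine H.not_wire_tgt _ ((isCore_map f _).2 he) ?_ ?_
      · rwa [f.src_onE, hmem _ _ hb]
      · rwa [f.tgt_onE, hmem _ _ hb]
    · rw [← isWire_map f, ← f.src_onE]
      refine H.not_wire_src _ ((isCore_map f _).2 he) ?_ ?_
      · rwa [f.tgt_onE, hmem _ _ hb]
      · rwa [f.src_onE, hmem _ _ hb]
    · rw [← hmem _ _ hb, ← hmem _ _ hb, ← f.src_onE, ← f.tgt_onE]
      exact H.not_fixed _ ((isCore_map f _).2 he) ((isFixed_map f _).2 hfe)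
  · intro b c hb hc hcb x hx
    exact (hmem b x hb).1 (hB.nested _ _ ((isBang_map f b).2 hb) ((isBang_map f c).2 hc)
      (mem_box_map f hcb) (mem_box_map f hx))

theorem isBangGraph_of_iso {A B : TypedGraph.{u} T} (a : A ≅ B) (hA : A.IsBangGraph) :
    B.IsBangGraph :=
  (isMono_iso a.symm).isBangGraph hA (fun e _ _ _ => iso_surjective_onE a.symm e)
    (fun _ _ e _ _ => iso_surjective_onE a.symm e)

theorem isBangGraph_full {A : TypedGraph.{u} T} (hA : A.IsBangGraph) (K : Set A.V)
    (hK : ∀ e, A.IsFixed e → (A.src e ∈ K ↔ A.tgt e ∈ K)) : (A.full K).graph.IsBangGraph := by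
  refine (A.full K).isMono_incl.isBangGraph hA ?_ ?_
  · rintro e - ⟨x, hx⟩ ⟨y, hy⟩
    exact ⟨⟨e, hx ▸ x.2, hy ▸ y.2⟩, rfl⟩
  · rintro ⟨x, hxK⟩ hx e he (rfl | rfl)
    · exact ⟨⟨e, hxK, (hK e he).1 hxK⟩, rfl⟩
    · exact ⟨⟨e, (hK e he).2 hxK, hxK⟩, rfl⟩

section Copy

variable {A : TypedGraph.{u} T} {b : A.V}

theorem TypedGraph.copyMap_onV_eq_iff {x y : A.V} {j k : Bool} :
    (A.copyMap b j).onV x = (A.copyMap b k).onV y ↔ x = y ∧ (x ∈ A.box b → j = k) := by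
  constructor
  · intro h
    have h1 : x = y := congrArg (fun t => t.1.1) h
    subst h1
    refine ⟨rfl, fun hx => ?_⟩
    have h2 := congrArg (fun t => t.1.2) h
    simpa [copyMap, copyV, hx] using h2
  · rintro ⟨rfl, h⟩
    by_cases hx : x ∈ A.box b
    · rw [h hx]
    · exact Subtype.ext (by simp [copyMap, copyV, hx])

theorem TypedGraph.copyMap_onE_eq_iff {x y : A.E} {j k : Bool} :
    (A.copyMap b j).onE x = (A.copyMap b k).onE y ↔ x = y ∧ (x ∈ A.touching b → j = k) := by
  constructor
  · intro h
    have h1 : x = y := congrArg (fun t => t.1.1) h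
    subst h1
    refine ⟨rfl, fun hx => ?_⟩
    have h2 := congrArg (fun t => t.1.2) h
    simpa [copyMap, copyE, hx] using h2
  · rintro ⟨rfl, h⟩
    by_cases hx : x ∈ A.touching b
    · rw [h hx]
    · exact Subtype.ext (by simp [copyMap, copyE, hx])

theorem TypedGraph.exists_copyMap_onV (x : (A.copy b).V) : ∃ k y, x = (A.copyMap b k).onV y := by
  obtain ⟨⟨y, k⟩, h⟩ := x
  refine ⟨k, y, Subtype.ext (Prod.ext rfl ?_)⟩
  by_cases hy : y ∈ A.box b
  · simp [copyMap, copyV, hy]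
  · have : k = false := by simpa using fun hk => hy (h hk)
    simp [copyMap, copyV, this]

theorem TypedGraph.exists_copyMap_onE (x : (A.copy b).E) : ∃ k y, x = (A.copyMap b k).onE y := by
  obtain ⟨⟨y, k⟩, h⟩ := x
  refine ⟨k, y, Subtype.ext (Prod.ext rfl ?_)⟩
  by_cases hy : y ∈ A.touching b
  · simp [copyMap, copyE, hy]
  · have : k = false := by simpa using fun hk => hy (h hk)
    simp [copyMap, copyE, this]

theorem TypedGraph.copy_src (k : Bool) (e : A.E) :
    (A.copy b).src ((A.copyMap b k).onE e) = (A.copyMap b k).onV (A.src e) :=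
  (A.copyMap b k).src_onE e

theorem TypedGraph.copy_tgt (k : Bool) (e : A.E) :
    (A.copy b).tgt ((A.copyMap b k).onE e) = (A.copyMap b k).onV (A.tgt e) :=
  (A.copyMap b k).tgt_onE e

/-- A !-vertex of `COPY_b(A)` that lies in one of the two copies of `B(b)` contains only vertices of
the same copy; any other !-vertex contains both copies of each vertex below it. -/
theorem TypedGraph.mem_box_copy_iff (hA : A.IsBangGraph) (hb : A.IsBang b) {c x : A.V}
    {j k : Bool} (hc : A.IsBang c) :
    (A.copyMap b k).onV x ∈ (A.copy b).box ((A.copyMap b j).onV c) ↔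
      x ∈ A.box c ∧ (c ∈ A.box b → j = k) := by
  have hn : c ∈ A.box b → x ∈ A.box c → x ∈ A.box b := fun h1 h2 => hA.nested b c hb hc h1 h2
  constructor
  · rintro ⟨e', hs, ht⟩
    obtain ⟨i, e, rfl⟩ := exists_copyMap_onE e'
    rw [copy_src, copyMap_onV_eq_iff] at hs
    rw [copy_tgt, copyMap_onV_eq_iff] at ht
    obtain ⟨rfl, hs⟩ := hs
    obtain ⟨rfl, ht⟩ := ht
    have hx : A.tgt e ∈ A.box (A.src e) := ⟨e, rfl, rfl⟩
    exact ⟨hx, fun h => (hs h).symm.trans (ht (hn h hx))⟩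
  · rintro ⟨⟨e, rfl, rfl⟩, h⟩
    refine ⟨(A.copyMap b k).onE e, ?_, copy_tgt k e⟩
    rw [copy_src, copyMap_onV_eq_iff]
    exact ⟨rfl, fun h' => (h h').symm⟩

theorem isBangGraph_copy (hA : A.IsBangGraph) (hb : A.IsBang b) : (A.copy b).IsBangGraph := by
  have hO := hA.box_open b hb
  have hfixed : ∀ e, A.IsFixed e → (A.src e ∈ A.box b ↔ A.tgt e ∈ A.box b) := fun e he =>
    hO.not_fixed e (TypedGraph.isCore_of_isFixed he) he
  have hbang : ∀ k x, (A.copy b).IsBang ((A.copyMap b k).onV x) ↔ A.IsBang x := fun k x =>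
    isBang_map (A.copyMap b k) x
  have hwire : ∀ k x, (A.copy b).IsWire ((A.copyMap b k).onV x) ↔ A.IsWire x := fun k x =>
    isWire_map (A.copyMap b k) x
  have hcore : ∀ k x, (A.copy b).IsCore ((A.copyMap b k).onE x) ↔ A.IsCore x := fun k x =>
    isCore_map (A.copyMap b k) x
  have hfix : ∀ k x, (A.copy b).IsFixed ((A.copyMap b k).onE x) ↔ A.IsFixed x := fun k x =>
    isFixed_map (A.copyMap b k) x
  refine
    { finite_V := ?_, finite_E := ?_, string := ⟨?_, ?_, ?_⟩, posetal := ⟨?_, ?_, ?_, ?_⟩,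
      box_open := ?_, nested := ?_ }
  · have := hA.finite_V
    exact Subtype.finite
  · have := hA.finite_E
    exact Subtype.finite
  · intro x' hx'
    obtain ⟨k, x, rfl⟩ := TypedGraph.exists_copyMap_onV x'
    have H := hA.string.arity x ((isNode_map (A.copyMap b k) x).1 hx')
    have hinc : ∀ j e, A.IsFixed e →
        (A.copy b).Incident ((A.copyMap b j).onE e) ((A.copyMap b k).onV x) →
        A.Incident e x ∧ (e ∈ A.touching b → j = k) := by
      intro j e he h
      unfold TypedGraph.Incident at *
      rw [TypedGraph.copy_src, TypedGraph.copy_tgt, TypedGraph.copyMap_onV_eq_iff,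
        TypedGraph.copyMap_onV_eq_iff] at h
      refine ⟨h.imp And.left And.left, fun ht => ?_⟩
      rcases ht with ht | ht
      · exact h.elim (fun h => h.2 ht) (fun h => h.2 ((hfixed e he).1 ht))
      · exact h.elim (fun h => h.2 ((hfixed e he).2 ht)) (fun h => h.2 ht)
    refine ⟨?_, ?_, ?_⟩
    · rintro e' ⟨hf, he⟩
      obtain ⟨j, e, rfl⟩ := TypedGraph.exists_copyMap_onE e'
      rw [hfix] at hf
      exact H.mapsTo ⟨hf, (hinc j e hf he).1⟩
    · rintro e₁' ⟨hf₁, he₁⟩ e₂' ⟨hf₂, he₂⟩ h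
      obtain ⟨j₁, e₁, rfl⟩ := TypedGraph.exists_copyMap_onE e₁'
      obtain ⟨j₂, e₂, rfl⟩ := TypedGraph.exists_copyMap_onE e₂'
      rw [hfix] at hf₁ hf₂
      have h₁ := hinc _ _ hf₁ he₁
      have h₂ := hinc _ _ hf₂ he₂
      obtain rfl : e₁ = e₂ := H.injOn ⟨hf₁, h₁.1⟩ ⟨hf₂, h₂.1⟩ h
      exact TypedGraph.copyMap_onE_eq_iff.2 ⟨rfl, fun ht => (h₁.2 ht).trans (h₂.2 ht).symm⟩
    · intro t ht
      obtain ⟨e, he, rfl⟩ := H.surjOn ht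
      exact ⟨(A.copyMap b k).onE e, ⟨(hfix k e).2 he.1,
        incident_map (f := A.copyMap b k) he.2⟩, rfl⟩
  · intro e₁' e₂' h₁ h₂ hw h
    obtain ⟨j₁, e₁, rfl⟩ := TypedGraph.exists_copyMap_onE e₁'
    obtain ⟨j₂, e₂, rfl⟩ := TypedGraph.exists_copyMap_onE e₂'
    rw [TypedGraph.copy_tgt, TypedGraph.copy_tgt, TypedGraph.copyMap_onV_eq_iff] at h
    rw [hcore] at h₁ h₂
    rw [TypedGraph.copy_tgt, hwire] at hw
    obtain rfl : e₁ = e₂ := hA.string.wire_in _ _ h₁ h₂ hw h.1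
    refine TypedGraph.copyMap_onE_eq_iff.2 ⟨rfl, fun ht => h.2 ?_⟩
    by_contra hn
    exact hO.not_wire_tgt e₁ h₁ (ht.resolve_right hn) hn hw
  · intro e₁' e₂' h₁ h₂ hw h
    obtain ⟨j₁, e₁, rfl⟩ := TypedGraph.exists_copyMap_onE e₁'
    obtain ⟨j₂, e₂, rfl⟩ := TypedGraph.exists_copyMap_onE e₂'
    rw [TypedGraph.copy_src, TypedGraph.copy_src, TypedGraph.copyMap_onV_eq_iff] at h
    rw [hcore] at h₁ h₂
    rw [TypedGraph.copy_src, hwire] at hw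
    obtain rfl : e₁ = e₂ := hA.string.wire_out _ _ h₁ h₂ hw h.1
    refine TypedGraph.copyMap_onE_eq_iff.2 ⟨rfl, fun ht => h.2 ?_⟩
    by_contra hn
    exact hO.not_wire_src e₁ h₁ (ht.resolve_left hn) hn hw
  · intro e₁' e₂' hbs hbt hs ht
    obtain ⟨j₁, e₁, rfl⟩ := TypedGraph.exists_copyMap_onE e₁'
    obtain ⟨j₂, e₂, rfl⟩ := TypedGraph.exists_copyMap_onE e₂'
    rw [TypedGraph.copy_src, hbang] at hbs
    rw [TypedGraph.copy_tgt, hbang] at hbt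
    rw [TypedGraph.copy_src, TypedGraph.copy_src, TypedGraph.copyMap_onV_eq_iff] at hs
    rw [TypedGraph.copy_tgt, TypedGraph.copy_tgt, TypedGraph.copyMap_onV_eq_iff] at ht
    obtain rfl : e₁ = e₂ := hA.posetal.simple _ _ hbs hbt hs.1 ht.1
    exact TypedGraph.copyMap_onE_eq_iff.2 ⟨rfl, fun h => h.elim hs.2 ht.2⟩
  · intro c' hc
    obtain ⟨j, c, rfl⟩ := TypedGraph.exists_copyMap_onV c'
    rw [hbang] at hc
    exact (TypedGraph.mem_box_copy_iff hA hb hc).2 ⟨hA.posetal.refl c hc, fun _ => rfl⟩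
  · intro c' d' hc hd h₁ h₂
    obtain ⟨j, c, rfl⟩ := TypedGraph.exists_copyMap_onV c'
    obtain ⟨k, d, rfl⟩ := TypedGraph.exists_copyMap_onV d'
    rw [hbang] at hc hd
    rw [TypedGraph.mem_box_copy_iff hA hb hc] at h₁
    rw [TypedGraph.mem_box_copy_iff hA hb hd] at h₂
    exact TypedGraph.copyMap_onV_eq_iff.2 ⟨hA.posetal.antisymm _ _ hc hd h₁.1 h₂.1, h₁.2⟩
  · intro a' c' d' ha hc hd h₁ h₂
    obtain ⟨i, a, rfl⟩ := TypedGraph.exists_copyMap_onV a'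
    obtain ⟨j, c, rfl⟩ := TypedGraph.exists_copyMap_onV c'
    obtain ⟨k, d, rfl⟩ := TypedGraph.exists_copyMap_onV d'
    rw [hbang] at ha hc hd
    rw [TypedGraph.mem_box_copy_iff hA hb ha] at h₁ ⊢
    rw [TypedGraph.mem_box_copy_iff hA hb hc] at h₂
    exact ⟨hA.posetal.trans _ _ _ ha hc hd h₁.1 h₂.1, fun h =>
      (h₁.2 h).trans (h₂.2 (hA.nested b a hb ha h h₁.1))⟩
  · intro c' hc
    obtain ⟨j, c, rfl⟩ := TypedGraph.exists_copyMap_onV c'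
    rw [hbang] at hc
    have H := hA.box_open c hc
    -- The two ends of an edge that both lie in `B(c)` lie in the same copy of `B(b)`, so membership
    -- of one end in a copied !-box implies that of the other.
    have key : ∀ k e, (A.src e ∈ A.box c ↔ A.tgt e ∈ A.box c) →
        ((A.copy b).src ((A.copyMap b k).onE e) ∈ (A.copy b).box ((A.copyMap b j).onV c) ↔
          (A.copy b).tgt ((A.copyMap b k).onE e) ∈ (A.copy b).box ((A.copyMap b j).onV c)) := by
      intro k e h
      rw [TypedGraph.copy_src, TypedGraph.copy_tgt, TypedGraph.mem_box_copy_iff hA hb hc,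
        TypedGraph.mem_box_copy_iff hA hb hc, h]
    refine ⟨fun e' he hs ht hw => ?_, fun e' he ht hs hw => ?_, fun e' he hfe => ?_⟩
    · obtain ⟨k, e, rfl⟩ := TypedGraph.exists_copyMap_onE e'
      have hs' := hs
      rw [TypedGraph.copy_src, TypedGraph.mem_box_copy_iff hA hb hc] at hs'
      refine H.not_wire_tgt e ((hcore _ _).1 he) hs'.1 (fun h => ht ?_) ?_
      · exact (key k e ⟨fun _ => h, fun _ => hs'.1⟩).1 hs
      · rwa [TypedGraph.copy_tgt, hwire] at hw
    · obtain ⟨k, e, rfl⟩ := TypedGraph.exists_copyMap_onE e'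
      have ht' := ht
      rw [TypedGraph.copy_tgt, TypedGraph.mem_box_copy_iff hA hb hc] at ht'
      refine H.not_wire_src e ((hcore _ _).1 he) ht'.1 (fun h => hs ?_) ?_
      · exact (key k e ⟨fun _ => ht'.1, fun _ => h⟩).2 ht
      · rwa [TypedGraph.copy_src, hwire] at hw
    · obtain ⟨k, e, rfl⟩ := TypedGraph.exists_copyMap_onE e'
      exact key k e (H.not_fixed e ((hcore _ _).1 he) ((hfix _ _).1 hfe))
  · intro c' d' hc hd hdc x' hx
    obtain ⟨j, c, rfl⟩ := TypedGraph.exists_copyMap_onV c'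
    obtain ⟨k, d, rfl⟩ := TypedGraph.exists_copyMap_onV d'
    obtain ⟨i, x, rfl⟩ := TypedGraph.exists_copyMap_onV x'
    rw [hbang] at hc hd
    rw [TypedGraph.mem_box_copy_iff hA hb hc] at hdc ⊢
    rw [TypedGraph.mem_box_copy_iff hA hb hd] at hx
    exact ⟨hA.nested _ _ hc hd hdc.1 hx.1, fun h =>
      (hdc.2 h).trans (hx.2 (hA.nested b c hb hc h hdc.1))⟩

end Copy

/-! ### !-box operations and their projections -/

/-- The map `COPY_b(A) ⟶ A` that folds the two copies. -/
noncomputable def copyFold (A : TypedGraph.{u} T) (b : A.V) : A.copy b ⟶ A where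
  onV x := x.1.1
  onE e := e.1.1
  src_onE _ := rfl
  tgt_onE _ := rfl
  typ_onV _ := rfl
  typ_onE _ := rfl

/-- The projection `OP_b(A) ⟶ A`: the folding map for COPY, the inclusion for DROP and KILL. -/
noncomputable def BoxOp.proj (op : BoxOp) (A : TypedGraph.{u} T) (b : A.V) : op.obj A b ⟶ A :=
  match op with
  | .COPY => copyFold A b
  | .DROP => (A.dropSub b).incl
  | .KILL => (A.killSub b).incl

theorem isBangGraph_op {A : TypedGraph.{u} T} {b : A.V} (hA : A.IsBangGraph) (hb : A.IsBang b)
    (op : BoxOp) : (op.obj A b).IsBangGraph := by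
  cases op
  · exact isBangGraph_copy hA hb
  · refine isBangGraph_full hA _ fun e he => ?_
    have hc := TypedGraph.isCore_of_isFixed he
    refine iff_of_true ?_ ?_
    · rintro rfl
      exact hc hb
    · rintro rfl
      exact hc (TypedGraph.isBang_src_of_tgt hb)
  · exact isBangGraph_full hA _ fun e he =>
      not_congr ((hA.box_open b hb).not_fixed e (TypedGraph.isCore_of_isFixed he) he)

/-- Every edge of `U(A)` at a wire-vertex lifts along `q`, with prescribed lift of that
wire-vertex. -/
structure LiftsWireEdges {A' A : TypedGraph.{u} T} (q : A' ⟶ A) : Prop where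
  tgt : ∀ x' e, A'.IsWire x' → A.IsCore e → A.tgt e = q.onV x' →
    ∃ e', q.onE e' = e ∧ A'.tgt e' = x'
  src : ∀ x' e, A'.IsWire x' → A.IsCore e → A.src e = q.onV x' →
    ∃ e', q.onE e' = e ∧ A'.src e' = x'

theorem liftsWireEdges_id (A : TypedGraph.{u} T) : LiftsWireEdges (𝟙 A) :=
  ⟨fun _ e _ _ h => ⟨e, rfl, h⟩, fun _ e _ _ h => ⟨e, rfl, h⟩⟩

theorem liftsWireEdges_iso {A B : TypedGraph.{u} T} (a : A ≅ B) : LiftsWireEdges a.hom := by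
  refine ⟨fun x e _ _ h => ?_, fun x e _ _ h => ?_⟩
  all_goals obtain ⟨e, rfl⟩ := iso_surjective_onE a e
  · exact ⟨e, rfl, (isMono_iso a).1 ((a.hom.tgt_onE e).symm.trans h)⟩
  · exact ⟨e, rfl, (isMono_iso a).1 ((a.hom.src_onE e).symm.trans h)⟩

/-- A !-box is open, so an edge of `U(A)` at a wire-vertex that survives DROP or KILL survives too;
in `COPY_b(A)` each copy of a vertex is met by a copy of every edge at it. -/
theorem liftsWireEdges_proj {A : TypedGraph.{u} T} {b : A.V} (hA : A.IsBangGraph)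
    (hb : A.IsBang b) (op : BoxOp) : LiftsWireEdges (op.proj A b) := by
  cases op
  · constructor
    · intro x' e _ _ h
      obtain ⟨k, x, rfl⟩ := TypedGraph.exists_copyMap_onV x'
      obtain rfl : A.tgt e = x := h
      exact ⟨(A.copyMap b k).onE e, rfl, TypedGraph.copy_tgt k e⟩
    · intro x' e _ _ h
      obtain ⟨k, x, rfl⟩ := TypedGraph.exists_copyMap_onV x'
      obtain rfl : A.src e = x := h
      exact ⟨(A.copyMap b k).onE e, rfl, TypedGraph.copy_src k e⟩
  · constructor
    · rintro ⟨x, hx⟩ e hw hc h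
      obtain rfl : A.tgt e = x := h
      exact ⟨⟨e, fun h => hc (h ▸ hb), hx⟩, rfl, rfl⟩
    · rintro ⟨x, hx⟩ e hw hc h
      obtain rfl : A.src e = x := h
      exact ⟨⟨e, hx, fun h => hc (TypedGraph.isBang_src_of_tgt (h ▸ hb))⟩, rfl, rfl⟩
  · constructor
    · rintro ⟨x, hx⟩ e hw hc h
      obtain rfl : A.tgt e = x := h
      exact ⟨⟨e, fun h => (hA.box_open b hb).not_wire_tgt e hc h hx hw, hx⟩, rfl, rfl⟩
    · rintro ⟨x, hx⟩ e hw hc h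
      obtain rfl : A.src e = x := h
      exact ⟨⟨e, hx, fun h => (hA.box_open b hb).not_wire_src e hc h hx hw⟩, rfl, rfl⟩

namespace LiftsWireEdges

variable {A' A : TypedGraph.{u} T} {q : A' ⟶ A}

theorem isInput_iff (hq : LiftsWireEdges q) (x : A'.V) :
    A.IsInput (q.onV x) ↔ A'.IsInput x := by
  unfold TypedGraph.IsInput
  rw [isWire_map]
  refine and_congr_right fun hw => ⟨fun h e he ht => ?_, fun h e he ht => ?_⟩
  · exact h (q.onE e) ((isCore_map q e).2 he) (by rw [q.tgt_onE, ht])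
  · obtain ⟨e, rfl, rfl⟩ := hq.tgt x e hw he ht
    exact h e ((isCore_map q e).1 he) rfl

theorem isOutput_iff (hq : LiftsWireEdges q) (x : A'.V) :
    A.IsOutput (q.onV x) ↔ A'.IsOutput x := by
  unfold TypedGraph.IsOutput
  rw [isWire_map]
  refine and_congr_right fun hw => ⟨fun h e he ht => ?_, fun h e he ht => ?_⟩
  · exact h (q.onE e) ((isCore_map q e).2 he) (by rw [q.src_onE, ht])
  · obtain ⟨e, rfl, rfl⟩ := hq.src x e hw he ht
    exact h e ((isCore_map q e).1 he) rfl

theorem mem_boundB_verts_iff (hq : LiftsWireEdges q) (x : A'.V) :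
    q.onV x ∈ A.boundB.verts ↔ x ∈ A'.boundB.verts :=
  or_congr (isBang_map q x) (or_congr (hq.isInput_iff x) (hq.isOutput_iff x))

theorem mem_boundB_edges_iff (hq : LiftsWireEdges q) (e : A'.E) :
    q.onE e ∈ A.boundB.edges ↔ e ∈ A'.boundB.edges := by
  change _ ∧ A.tgt _ ∈ A.boundB.verts ↔ _ ∧ A'.tgt _ ∈ A'.boundB.verts
  rw [q.src_onE, q.tgt_onE, isBang_map, hq.mem_boundB_verts_iff]

theorem noIsolatedWires (hq : LiftsWireEdges q) (hA : A.NoIsolatedWires) :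
    A'.NoIsolatedWires := by
  intro x hx
  obtain ⟨e, he, hs | ht⟩ := hA _ ((isWire_map q x).2 hx)
  · obtain ⟨e, rfl, rfl⟩ := hq.src x e hx he hs
    exact ⟨e, (isCore_map q e).1 he, Or.inl rfl⟩
  · obtain ⟨e, rfl, rfl⟩ := hq.tgt x e hx he ht
    exact ⟨e, (isCore_map q e).1 he, Or.inr rfl⟩

end LiftsWireEdges

/-! ### !-box operations on morphisms -/

section OpMap

variable {A B C : TypedGraph.{u} T}

theorem IsOpMap.onV_eq {f : A ⟶ B} {b : A.V} {c : B.V} {op : BoxOp}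
    {f' : op.obj A b ⟶ op.obj B c} (h : IsOpMap f b c op f') : f.onV b = c := by
  cases op <;> exact h.1

theorem IsOpMap.unique {f : A ⟶ B} {b : A.V} {c : B.V} {op : BoxOp}
    {f₁ f₂ : op.obj A b ⟶ op.obj B c} (h₁ : IsOpMap f b c op f₁) (h₂ : IsOpMap f b c op f₂) :
    f₁ = f₂ := by
  cases op
  · exact (copy_isPushout A b).hom_ext ((h₁.2 false).trans (h₂.2 false).symm)
      ((h₁.2 true).trans (h₂.2 true).symm)
  · exact (B.dropSub c).isMono_incl.cancel (h₁.2.trans h₂.2.symm)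
  · exact (B.killSub c).isMono_incl.cancel (h₁.2.trans h₂.2.symm)

theorem IsOpMap.comp {f : A ⟶ B} {g : B ⟶ C} {a : A.V} {b : B.V} {c : C.V} {op : BoxOp}
    {f' : op.obj A a ⟶ op.obj B b} {g' : op.obj B b ⟶ op.obj C c}
    (hf : IsOpMap f a b op f') (hg : IsOpMap g b c op g') :
    IsOpMap (f ≫ g) a c op (f' ≫ g') := by
  have hc : (f ≫ g).onV a = c := by rw [comp_onV, hf.onV_eq, hg.onV_eq]
  cases op
  · refine ⟨hc, fun k => ?_⟩
    refine (congrArg (· ≫ (g' : B.copy b ⟶ C.copy c)) (hf.2 k)).trans ?_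
    exact congrArg (f ≫ ·) (hg.2 k)
  · refine ⟨hc, ?_⟩
    refine (congrArg ((f' : (A.dropSub a).graph ⟶ (B.dropSub b).graph) ≫ ·) hg.2).trans ?_
    exact congrArg (· ≫ g) hf.2
  · refine ⟨hc, ?_⟩
    refine (congrArg ((f' : (A.killSub a).graph ⟶ (B.killSub b).graph) ≫ ·) hg.2).trans ?_
    exact congrArg (· ≫ g) hf.2

theorem IsOpMapOutside.notMem_range {f : A ⟶ B} {c : B.V} {op : BoxOp} {f' : A ⟶ op.obj B c}
    (h : IsOpMapOutside f c op f') : c ∉ Set.range f.onV := by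
  cases op <;> exact h.1

theorem IsOpMapOutside.unique {f : A ⟶ B} {c : B.V} {op : BoxOp} {f₁ f₂ : A ⟶ op.obj B c}
    (h₁ : IsOpMapOutside f c op f₁) (h₂ : IsOpMapOutside f c op f₂) : f₁ = f₂ := by
  cases op
  · exact (h₁.2 false).trans (h₂.2 false).symm
  · exact (B.dropSub c).isMono_incl.cancel (h₁.2.trans h₂.2.symm)
  · exact (B.killSub c).isMono_incl.cancel (h₁.2.trans h₂.2.symm)

theorem IsOpMapOutside.comp_left {g : B ⟶ C} {c : C.V} {op : BoxOp} {g' : B ⟶ op.obj C c}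
    (hg : IsOpMapOutside g c op g') (f : A ⟶ B) : IsOpMapOutside (f ≫ g) c op (f ≫ g') := by
  have hc : c ∉ Set.range (f ≫ g).onV := fun ⟨x, hx⟩ => hg.notMem_range ⟨_, hx⟩
  cases op
  · exact ⟨hc, fun k => congrArg (f ≫ ·) (hg.2 k)⟩
  · exact ⟨hc, congrArg (f ≫ ·) hg.2⟩
  · exact ⟨hc, congrArg (f ≫ ·) hg.2⟩

theorem IsOpMapOutside.comp_right {f : A ⟶ B} {g : B ⟶ C} {b : B.V} {c : C.V} {op : BoxOp}
    {f' : A ⟶ op.obj B b} {g' : op.obj B b ⟶ op.obj C c} (hf : IsOpMapOutside f b op f')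
    (hg : IsOpMap g b c op g') (hc : c ∉ Set.range (f ≫ g).onV) :
    IsOpMapOutside (f ≫ g) c op (f' ≫ g') := by
  cases op
  · refine ⟨hc, fun k => ?_⟩
    refine (congrArg (· ≫ (g' : B.copy b ⟶ C.copy c)) (hf.2 k)).trans ?_
    exact congrArg (f ≫ ·) (hg.2 k)
  · refine ⟨hc, ?_⟩
    refine (congrArg ((f' : A ⟶ (B.dropSub b).graph) ≫ ·) hg.2).trans ?_
    exact congrArg (· ≫ g) hf.2
  · refine ⟨hc, ?_⟩
    refine (congrArg ((f' : A ⟶ (B.killSub b).graph) ≫ ·) hg.2).trans ?_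
    exact congrArg (· ≫ g) hf.2

theorem ReflectsBox.mem_box_iff {f : A ⟶ B} (hr : ReflectsBox f) (hf : IsMono f) {b x : A.V}
    (hb : A.IsBang b) : f.onV x ∈ B.box (f.onV b) ↔ x ∈ A.box b := by
  refine ⟨?_, mem_box_map f⟩
  rintro ⟨e, hs, ht⟩
  obtain ⟨e, rfl⟩ := hr e (by rwa [hs, isBang_map]) ⟨_, ht.symm⟩
  rw [f.src_onE] at hs
  rw [f.tgt_onE] at ht
  exact ⟨e, hf.1 hs, hf.1 ht⟩

theorem ReflectsBox.notMem_box {f : A ⟶ B} (hr : ReflectsBox f) {c : B.V} (hc : B.IsBang c)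
    (hn : c ∉ Set.range f.onV) (x : A.V) : f.onV x ∉ B.box c := by
  rintro ⟨e, rfl, ht⟩
  obtain ⟨e, rfl⟩ := hr e hc ⟨_, ht.symm⟩
  exact hn ⟨_, (f.src_onE e).symm⟩

/-- The reflection of !-box containment makes `f` map the complement of `B(b)` into the complement
of `B(f b)`; this is what `KILL` and the gluing of the two copies in `COPY` require. -/
theorem exists_isOpMap {f : A ⟶ B} (hf : IsMono f) (hr : ReflectsBox f) {b : A.V} {c : B.V}
    (hb : A.IsBang b) (hbc : f.onV b = c) (op : BoxOp) : ∃ f', IsOpMap f b c op f' := by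
  subst hbc
  have hbox : ∀ x, x ∉ A.box b → f.onV x ∉ B.box (f.onV b) := fun x hx =>
    (not_congr (hr.mem_box_iff hf hb)).2 hx
  cases op
  · have hw : (A.killSub b).incl ≫ f ≫ B.copyMap (f.onV b) false =
        (A.killSub b).incl ≫ f ≫ B.copyMap (f.onV b) true := by
      refine hom_ext ?_ ?_
      · rintro ⟨x, hx⟩
        exact TypedGraph.copyMap_onV_eq_iff.2 ⟨rfl, fun h => (hbox x hx h).elim⟩
      · rintro ⟨e, hs, ht⟩
        refine TypedGraph.copyMap_onE_eq_iff.2 ⟨rfl, fun h => ?_⟩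
        rcases h with h | h
        · replace h : B.src (f.onE e) ∈ B.box (f.onV b) := h
          rw [f.src_onE] at h
          exact (hbox _ hs h).elim
        · replace h : B.tgt (f.onE e) ∈ B.box (f.onV b) := h
          rw [f.tgt_onE] at h
          exact (hbox _ ht h).elim
    refine ⟨(copy_isPushout A b).desc _ _ hw, rfl, fun k => ?_⟩
    cases k
    · exact (copy_isPushout A b).inl_desc _ _ hw
    · exact (copy_isPushout A b).inr_desc _ _ hw
  · refine ⟨(B.dropSub (f.onV b)).lift ((A.dropSub b).incl ≫ f)
      (fun x h => x.2 (hf.1 h)) (fun e => ⟨fun h => ?_, fun h => ?_⟩), rfl, rfl⟩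
    · exact e.2.1 (hf.1 ((f.src_onE e.1).symm.trans h))
    · exact e.2.2 (hf.1 ((f.tgt_onE e.1).symm.trans h))
  · refine ⟨(B.killSub (f.onV b)).lift ((A.killSub b).incl ≫ f)
      (fun x => hbox _ x.2) (fun e => ⟨?_, ?_⟩), rfl, rfl⟩
    · change B.src (f.onE e.1) ∉ _
      rw [f.src_onE]
      exact hbox _ e.2.1
    · change B.tgt (f.onE e.1) ∉ _
      rw [f.tgt_onE]
      exact hbox _ e.2.2

/-- If `c` is outside the image of `f`, then reflection of !-box containment keeps the whole image
of `f` outside `B(c)`. -/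
theorem exists_isOpMapOutside {f : A ⟶ B} (hr : ReflectsBox f) {c : B.V} (hc : B.IsBang c)
    (hn : c ∉ Set.range f.onV) (op : BoxOp) : ∃ f', IsOpMapOutside f c op f' := by
  have hbox := hr.notMem_box hc hn
  cases op
  · refine ⟨f ≫ B.copyMap c false, hn, fun k => hom_ext (fun x => ?_) (fun e => ?_)⟩
    · exact TypedGraph.copyMap_onV_eq_iff.2 ⟨rfl, fun h => (hbox x h).elim⟩
    · refine TypedGraph.copyMap_onE_eq_iff.2 ⟨rfl, fun h => ?_⟩
      rcases h with h | h
      · rw [f.src_onE] at h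
        exact (hbox _ h).elim
      · rw [f.tgt_onE] at h
        exact (hbox _ h).elim
  · refine ⟨(B.dropSub c).lift f (fun x h => hn ⟨x, h⟩) (fun e =>
      ⟨fun h => hn ⟨A.src e, (f.src_onE e).symm.trans h⟩,
        fun h => hn ⟨A.tgt e, (f.tgt_onE e).symm.trans h⟩⟩), hn, rfl⟩
  · refine ⟨(B.killSub c).lift f hbox (fun e => ⟨?_, ?_⟩), hn, rfl⟩
    · change B.src (f.onE e) ∉ _
      rw [f.src_onE]
      exact hbox _
    · change B.tgt (f.onE e) ∉ _
      rw [f.tgt_onE]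
      exact hbox _

end OpMap

/-! ### Base change of monomorphisms -/

/-- `f'` is the base change of `f` along `q`: `f'` is a monomorphism whose image is the preimage of
the image of `f`. For a monomorphism `f` the square is then a pullback. -/
structure IsBaseChange {A' B' A B : TypedGraph.{u} T} (f' : A' ⟶ B') (f : A ⟶ B) (p : A' ⟶ A)
    (q : B' ⟶ B) : Prop where
  comm : f' ≫ q = p ≫ f
  mono : IsMono f'
  rangeV : ∀ y, q.onV y ∈ Set.range f.onV → y ∈ Set.range f'.onV
  rangeE : ∀ e, q.onE e ∈ Set.range f.onE → e ∈ Set.range f'.onE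

theorem isBaseChange_id {A B : TypedGraph.{u} T} {f : A ⟶ B} (hf : IsMono f) :
    IsBaseChange f f (𝟙 A) (𝟙 B) :=
  ⟨rfl, hf, fun _ h => h, fun _ h => h⟩

theorem isBaseChange_iso {A B B' : TypedGraph.{u} T} {f : A ⟶ B} (hf : IsMono f) (a : B ≅ B') :
    IsBaseChange (f ≫ a.hom) f (𝟙 A) a.inv where
  comm := by rw [Category.assoc, a.hom_inv_id, Category.comp_id, Category.id_comp]
  mono := hf.comp (isMono_iso a)
  rangeV := by
    rintro y ⟨x, hx⟩
    exact ⟨x, (congrArg a.hom.onV hx).trans (congr_onV a.inv_hom_id y)⟩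
  rangeE := by
    rintro y ⟨x, hx⟩
    exact ⟨x, (congrArg a.hom.onE hx).trans (congr_onE a.inv_hom_id y)⟩

section BaseChange

variable {A' B' A B : TypedGraph.{u} T} {f' : A' ⟶ B'} {f : A ⟶ B} {p : A' ⟶ A} {q : B' ⟶ B}

namespace IsBaseChange

theorem commV (h : IsBaseChange f' f p q) (x : A'.V) : q.onV (f'.onV x) = f.onV (p.onV x) :=
  congr_onV h.comm x

theorem commE (h : IsBaseChange f' f p q) (x : A'.E) : q.onE (f'.onE x) = f.onE (p.onE x) :=
  congr_onE h.comm x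

theorem mem_rangeV (h : IsBaseChange f' f p q) (y : B'.V) :
    y ∈ Set.range f'.onV ↔ q.onV y ∈ Set.range f.onV :=
  ⟨fun ⟨x, hx⟩ => ⟨p.onV x, by rw [← h.commV, hx]⟩, h.rangeV y⟩

theorem mem_rangeE (h : IsBaseChange f' f p q) (y : B'.E) :
    y ∈ Set.range f'.onE ↔ q.onE y ∈ Set.range f.onE :=
  ⟨fun ⟨x, hx⟩ => ⟨p.onE x, by rw [← h.commE, hx]⟩, h.rangeE y⟩

theorem liftV (h : IsBaseChange f' f p q) (hf : IsMono f) {x : A.V} {y : B'.V}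
    (hxy : f.onV x = q.onV y) : ∃ z, p.onV z = x ∧ f'.onV z = y := by
  obtain ⟨z, rfl⟩ := h.rangeV y ⟨x, hxy⟩
  exact ⟨z, hf.1 ((h.commV z).symm.trans hxy.symm), rfl⟩

theorem liftE (h : IsBaseChange f' f p q) (hf : IsMono f) {x : A.E} {y : B'.E}
    (hxy : f.onE x = q.onE y) : ∃ z, p.onE z = x ∧ f'.onE z = y := by
  obtain ⟨z, rfl⟩ := h.rangeE y ⟨x, hxy⟩
  exact ⟨z, hf.2 ((h.commE z).symm.trans hxy.symm), rfl⟩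

theorem reflectsBox (h : IsBaseChange f' f p q) (hf : ReflectsBox f) : ReflectsBox f' := by
  rintro e hb ⟨x, hx⟩
  refine h.rangeE e (hf _ ?_ ⟨p.onV x, ?_⟩)
  · rwa [q.src_onE, isBang_map]
  · rw [q.tgt_onE, ← hx, h.commV]

theorem coreLocalIso (h : IsBaseChange f' f p q) (hf : CoreLocalIso f) : CoreLocalIso f' := by
  intro x hx
  refine ⟨?_, fun _ _ _ _ he => h.mono.2 he, ?_⟩
  · exact fun e he => ⟨(isCore_map f' e).2 he.1, incident_map he.2⟩
  · rintro e ⟨hc, hi⟩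
    have H := (hf (p.onV x) ((isNode_map p x).2 hx)).surjOn
    rw [← h.commV] at H
    obtain ⟨e₀, -, he₀⟩ := H ⟨(isCore_map q e).2 hc, incident_map hi⟩
    obtain ⟨e, rfl⟩ := h.rangeE e ⟨e₀, he₀⟩
    exact ⟨e, ⟨(isCore_map f' e).1 hc, h.mono.incident_iff.1 hi⟩, rfl⟩

theorem isMatching (h : IsBaseChange f' f p q) (hf : IsMatching f) (hA : A'.IsBangGraph)
    (hB : B'.IsBangGraph) : IsMatching f' :=
  ⟨hA, hB, h.mono, h.coreLocalIso hf.localIso, h.reflectsBox hf.reflects⟩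

end IsBaseChange

end BaseChange

/-- Pushout squares of monomorphisms are stable under base change. -/
theorem IsGluing.baseChange {I L D G I' L' D' G' : TypedGraph.{u} T}
    {i : I ⟶ L} {d : I ⟶ D} {m : L ⟶ G} {g : D ⟶ G}
    {i' : I' ⟶ L'} {d' : I' ⟶ D'} {m' : L' ⟶ G'} {g' : D' ⟶ G'}
    {pI : I' ⟶ I} {pL : L' ⟶ L} {pD : D' ⟶ D} {pG : G' ⟶ G}
    (h : IsGluing i d m g) (hi : IsMono i)
    (bi : IsBaseChange i' i pI pL) (bm : IsBaseChange m' m pL pG)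
    (bg : IsBaseChange g' g pD pG) (comm : i' ≫ m' = d' ≫ g') : IsGluing i' d' m' g' where
  comm := comm
  coverV x := (h.coverV (pG.onV x)).imp (bm.rangeV x) (bg.rangeV x)
  coverE x := (h.coverE (pG.onE x)).imp (bm.rangeE x) (bg.rangeE x)
  meetV y x hyx := by
    obtain ⟨z, hz, -⟩ := h.meetV (pL.onV y) (pD.onV x) (by rw [← bm.commV, hyx, bg.commV])
    obtain ⟨z', -, rfl⟩ := bi.liftV hi hz
    exact ⟨z', rfl, bg.mono.1 ((congr_onV comm z').symm.trans hyx)⟩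
  meetE y x hyx := by
    obtain ⟨z, hz, -⟩ := h.meetE (pL.onE y) (pD.onE x) (by rw [← bm.commE, hyx, bg.commE])
    obtain ⟨z', -, rfl⟩ := bi.liftE hi hz
    exact ⟨z', rfl, bg.mono.2 ((congr_onE comm z').symm.trans hyx)⟩

section OpBaseChange

variable {A B : TypedGraph.{u} T} {f : A ⟶ B}

theorem IsOpMap.comm_proj {b : A.V} {c : B.V} {op : BoxOp} {f' : op.obj A b ⟶ op.obj B c}
    (h : IsOpMap f b c op f') : f' ≫ op.proj B c = op.proj A b ≫ f := by
  cases op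
  · have H : ∀ k, A.copyMap b k ≫ (f' : A.copy b ⟶ B.copy c) ≫ copyFold B c =
        A.copyMap b k ≫ copyFold A b ≫ f := fun k =>
      congrArg (· ≫ copyFold B c) (h.2 k)
    exact (copy_isPushout A b).hom_ext (H false) (H true)
  · exact h.2
  · exact h.2

/-- `OP(f)` is the base change of `f` along the projection, so that the !-box operations preserve
everything that pulls back along it. -/
theorem IsOpMap.isBaseChange {b : A.V} {c : B.V} {op : BoxOp} {f' : op.obj A b ⟶ op.obj B c}
    (h : IsOpMap f b c op f') (hf : IsMono f) :
    IsBaseChange f' f (op.proj A b) (op.proj B c) := by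
  have hbc := h.onV_eq
  subst hbc
  have hcomm := h.comm_proj
  cases op
  · have hV : ∀ k x, f'.onV ((A.copyMap b k).onV x) = (B.copyMap (f.onV b) k).onV (f.onV x) :=
      fun k x => congr_onV (h.2 k) x
    have hE : ∀ k x, f'.onE ((A.copyMap b k).onE x) = (B.copyMap (f.onV b) k).onE (f.onE x) :=
      fun k x => congr_onE (h.2 k) x
    refine ⟨hcomm, ⟨fun x' y' hxy => ?_, fun x' y' hxy => ?_⟩, ?_, ?_⟩
    · obtain ⟨j, x, rfl⟩ := TypedGraph.exists_copyMap_onV x'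
      obtain ⟨k, y, rfl⟩ := TypedGraph.exists_copyMap_onV y'
      have hxy' := TypedGraph.copyMap_onV_eq_iff.1 ((hV j x).symm.trans (hxy.trans (hV k y)))
      exact TypedGraph.copyMap_onV_eq_iff.2
        ⟨hf.1 hxy'.1, fun hx => hxy'.2 (mem_box_map f hx)⟩
    · obtain ⟨j, x, rfl⟩ := TypedGraph.exists_copyMap_onE x'
      obtain ⟨k, y, rfl⟩ := TypedGraph.exists_copyMap_onE y'
      have hxy' := TypedGraph.copyMap_onE_eq_iff.1 ((hE j x).symm.trans (hxy.trans (hE k y)))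
      refine TypedGraph.copyMap_onE_eq_iff.2 ⟨hf.2 hxy'.1, fun hx => hxy'.2 ?_⟩
      refine hx.imp (fun hx => ?_) (fun hx => ?_)
      · rw [f.src_onE]; exact mem_box_map f hx
      · rw [f.tgt_onE]; exact mem_box_map f hx
    · rintro y' ⟨x, hx⟩
      obtain ⟨k, y, rfl⟩ := TypedGraph.exists_copyMap_onV y'
      obtain rfl : f.onV x = y := hx
      exact ⟨_, hV k x⟩
    · rintro y' ⟨x, hx⟩
      obtain ⟨k, y, rfl⟩ := TypedGraph.exists_copyMap_onE y'
      obtain rfl : f.onE x = y := hx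
      exact ⟨_, hE k x⟩
  · refine ⟨hcomm, ?_, ?_, ?_⟩
    · refine IsMono.of_comp (g := (B.dropSub (f.onV b)).incl) ?_
      exact (congrArg IsMono h.2).mpr ((A.dropSub b).isMono_incl.comp hf)
    · rintro ⟨y, hy⟩ ⟨x, hx⟩
      obtain rfl : f.onV x = y := hx
      refine ⟨⟨x, fun h => hy (congrArg _ h)⟩, Subtype.ext (congr_onV h.2 _)⟩
    · rintro ⟨y, hs, ht⟩ ⟨x, hx⟩
      obtain rfl : f.onE x = y := hx
      refine ⟨⟨x, fun h => hs ?_, fun h => ht ?_⟩, Subtype.ext (congr_onE h.2 _)⟩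
      · rw [f.src_onE, h]
      · rw [f.tgt_onE, h]
  · refine ⟨hcomm, ?_, ?_, ?_⟩
    · refine IsMono.of_comp (g := (B.killSub (f.onV b)).incl) ?_
      exact (congrArg IsMono h.2).mpr ((A.killSub b).isMono_incl.comp hf)
    · rintro ⟨y, hy⟩ ⟨x, hx⟩
      obtain rfl : f.onV x = y := hx
      refine ⟨⟨x, fun h => hy (mem_box_map f h)⟩, Subtype.ext (congr_onV h.2 _)⟩
    · rintro ⟨y, hs, ht⟩ ⟨x, hx⟩
      obtain rfl : f.onE x = y := hx
      refine ⟨⟨x, fun h => hs ?_, fun h => ht ?_⟩, Subtype.ext (congr_onE h.2 _)⟩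
      · rw [f.src_onE]; exact mem_box_map f h
      · rw [f.tgt_onE]; exact mem_box_map f h

theorem IsOpMapOutside.comm_proj {c : B.V} {op : BoxOp} {f' : A ⟶ op.obj B c}
    (h : IsOpMapOutside f c op f') : f' ≫ op.proj B c = f := by
  cases op
  · exact congrArg (· ≫ copyFold B c) (h.2 false)
  · exact h.2
  · exact h.2

/-- Here the graph `A` is left alone: the preimage in `OP_c(B)` of the image of `f` is a single copy
of `A`. -/
theorem IsOpMapOutside.isBaseChange {c : B.V} {op : BoxOp} {f' : A ⟶ op.obj B c}
    (h : IsOpMapOutside f c op f') (hf : IsMono f) : IsBaseChange f' f (𝟙 A) (op.proj B c) := by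
  have hcomm := h.comm_proj
  refine ⟨hcomm, IsMono.of_comp (by rwa [hcomm]), ?_, ?_⟩
  · cases op
    · rintro y' ⟨x, hx⟩
      obtain ⟨k, y, rfl⟩ := TypedGraph.exists_copyMap_onV y'
      obtain rfl : f.onV x = y := hx
      exact ⟨x, congr_onV (h.2 k) x⟩
    · exact fun y ⟨x, hx⟩ => ⟨x, Subtype.ext ((congr_onV h.2 x).trans hx)⟩
    · exact fun y ⟨x, hx⟩ => ⟨x, Subtype.ext ((congr_onV h.2 x).trans hx)⟩
  · cases op
    · rintro y' ⟨x, hx⟩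
      obtain ⟨k, y, rfl⟩ := TypedGraph.exists_copyMap_onE y'
      obtain rfl : f.onE x = y := hx
      exact ⟨x, congr_onE (h.2 k) x⟩
    · exact fun y ⟨x, hx⟩ => ⟨x, Subtype.ext ((congr_onE h.2 x).trans hx)⟩
    · exact fun y ⟨x, hx⟩ => ⟨x, Subtype.ext ((congr_onE h.2 x).trans hx)⟩

end OpBaseChange

/-! ### Boundaries and rewrite rules -/

/-- The morphism `i` is, up to isomorphism, the inclusion of `Bound_!(A)` into `A`. -/
structure IsBoundaryIncl {I A : TypedGraph.{u} T} (i : I ⟶ A) : Prop where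
  mono : IsMono i
  rangeV : Set.range i.onV = A.boundB.verts
  rangeE : Set.range i.onE = A.boundB.edges

/-- The span is, up to isomorphism, `A ⟵ Bound_!(A) ≅ Bound_!(B) ⟶ B`, where the middle isomorphism
preserves inputs and outputs. -/
structure IsBoundarySpan {I A B : TypedGraph.{u} T} (i : I ⟶ A) (j : I ⟶ B) : Prop where
  left : IsBoundaryIncl i
  right : IsBoundaryIncl j
  input : ∀ z, A.IsInput (i.onV z) ↔ B.IsInput (j.onV z)
  output : ∀ z, A.IsOutput (i.onV z) ↔ B.IsOutput (j.onV z)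

theorem IsBoundarySpan.symm {I A B : TypedGraph.{u} T} {i : I ⟶ A} {j : I ⟶ B}
    (h : IsBoundarySpan i j) : IsBoundarySpan j i :=
  ⟨h.right, h.left, fun z => (h.input z).symm, fun z => (h.output z).symm⟩

theorem TypedGraph.IsInput.not_isBang {A : TypedGraph.{u} T} {x : A.V} (h : A.IsInput x) :
    ¬ A.IsBang x := h.1.not_isBang

theorem TypedGraph.IsOutput.not_isBang {A : TypedGraph.{u} T} {x : A.V} (h : A.IsOutput x) :
    ¬ A.IsBang x := h.1.not_isBang

/-- `In_!(A)` and `Out_!(A)` together cover `Bound_!(A)`, so compatibility with their inclusions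
determines the composite `Bound_!(A) ⟶ I ⟶ A`. -/
theorem isBoundaryIncl_of_iso {I A : TypedGraph.{u} T} {i : I ⟶ A} (φ : A.boundB.graph ≅ I)
    (hin : (A.inToBound ≫ φ.hom) ≫ i = A.inB.incl)
    (hout : (A.outToBound ≫ φ.hom) ≫ i = A.outB.incl) : IsBoundaryIncl i := by
  have h : φ.hom ≫ i = A.boundB.incl := by
    refine hom_ext ?_ ?_
    · rintro ⟨x, hx | hx | hx⟩
      · exact congr_onV hin ⟨x, Or.inl hx⟩
      · exact congr_onV hin ⟨x, Or.inr hx⟩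
      · exact congr_onV hout ⟨x, Or.inr hx⟩
    · rintro ⟨e, hs, ht | ht | ht⟩
      · exact congr_onE hin ⟨e, Or.inl hs, Or.inl ht⟩
      · exact congr_onE hin ⟨e, Or.inl hs, Or.inr ht⟩
      · exact congr_onE hout ⟨e, Or.inl hs, Or.inr ht⟩
  have h' : i = φ.inv ≫ A.boundB.incl := by rw [← h, φ.inv_hom_id_assoc]
  refine ⟨h' ▸ (isMono_iso φ.symm).comp A.boundB.isMono_incl, ?_, ?_⟩
  · refine Set.Subset.antisymm ?_ fun x hx => ⟨_, congr_onV h ⟨x, hx⟩⟩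
    rintro _ ⟨z, rfl⟩
    rw [h']
    exact (φ.inv.onV z).2
  · refine Set.Subset.antisymm ?_ fun x hx => ⟨_, congr_onE h ⟨x, hx⟩⟩
    rintro _ ⟨z, rfl⟩
    rw [h']
    exact (φ.inv.onE z).2

/-- An isomorphism of subgraphs of `A` and `B` over `I` carries membership in the first to
membership in the second. For `In_!` it shows that inputs correspond to inputs, for `Out_!` the same
for outputs. -/
theorem mem_full_of_iso {I A B : TypedGraph.{u} T} {i : I ⟶ A} {j : I ⟶ B}
    {K : A.Subgraph} {K' : B.Subgraph} (φ : K.graph ≅ K'.graph) (a : K.graph ⟶ I)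
    (b : K'.graph ⟶ I) (ha : a ≫ i = K.incl) (hb : b ≫ j = K'.incl) (h : φ.hom ≫ b = a)
    (hi : IsMono i) (z : I.V) (hz : i.onV z ∈ K.verts) : j.onV z ∈ K'.verts := by
  have hz' : a.onV ⟨i.onV z, hz⟩ = z := hi.1 (congr_onV ha ⟨i.onV z, hz⟩)
  have h' : j.onV (a.onV ⟨i.onV z, hz⟩) = (φ.hom.onV ⟨i.onV z, hz⟩).1 :=
    (congrArg j.onV (congr_onV h.symm _)).trans (congr_onV hb _)
  rw [hz'] at h'
  exact h' ▸ (φ.hom.onV _).2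

theorem RuleSpan.IsRule.isBoundarySpan {S : RuleSpan.{u} T} (h : S.IsRule) :
    IsBoundarySpan S.i₁ S.i₂ := by
  obtain ⟨φI, φO, φL, φR, h₁, h₂, h₃, h₄, h₅, h₆⟩ := h.boundary
  have hL := isBoundaryIncl_of_iso φL h₁ h₂
  have hR := isBoundaryIncl_of_iso φR h₃ h₄
  have h₅' : φI.inv ≫ S.L.inToBound ≫ φL.hom = S.R.inToBound ≫ φR.hom := by
    rw [← h₅, φI.inv_hom_id_assoc]
  have h₆' : φO.inv ≫ S.L.outToBound ≫ φL.hom = S.R.outToBound ≫ φR.hom := by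
    rw [← h₆, φO.inv_hom_id_assoc]
  refine ⟨hL, hR, fun z => ⟨fun hz => ?_, fun hz => ?_⟩, fun z => ⟨fun hz => ?_, fun hz => ?_⟩⟩
  · refine (mem_full_of_iso φI _ _ h₁ h₃ h₅ hL.mono z (Or.inr hz)).resolve_left ?_
    rw [isBang_map, ← isBang_map S.i₁]
    exact hz.not_isBang
  · refine (mem_full_of_iso φI.symm _ _ h₃ h₁ h₅' hR.mono z (Or.inr hz)).resolve_left ?_
    rw [isBang_map, ← isBang_map S.i₂]
    exact hz.not_isBang
  · refine (mem_full_of_iso φO _ _ h₂ h₄ h₆ hL.mono z (Or.inr hz)).resolve_left ?_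
    rw [isBang_map, ← isBang_map S.i₁]
    exact hz.not_isBang
  · refine (mem_full_of_iso φO.symm _ _ h₄ h₂ h₆' hR.mono z (Or.inr hz)).resolve_left ?_
    rw [isBang_map, ← isBang_map S.i₂]
    exact hz.not_isBang

/-- A subgraph `K` of `Bound_!(A)` and a subgraph `K'` of `Bound_!(B)` that correspond to each other
in the middle of a boundary span are isomorphic over it. -/
theorem exists_iso_over {I A B : TypedGraph.{u} T} {i : I ⟶ A} {j : I ⟶ B} (hi : IsMono i)
    (hj : IsMono j) {K : A.Subgraph} {K' : B.Subgraph} (a : K.graph ⟶ I) (b : K'.graph ⟶ I)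
    (ha : a ≫ i = K.incl) (hb : b ≫ j = K'.incl)
    (hV : ∀ z, i.onV z ∈ K.verts ↔ j.onV z ∈ K'.verts)
    (hE : ∀ z, i.onE z ∈ K.edges ↔ j.onE z ∈ K'.edges) :
    ∃ φ : K.graph ≅ K'.graph, φ.hom ≫ b = a := by
  have hm : IsMono (a ≫ j) := (IsMono.of_comp (ha ▸ K.isMono_incl)).comp hj
  have haV : ∀ z (hz : i.onV z ∈ K.verts), a.onV ⟨_, hz⟩ = z := fun z hz =>
    hi.1 (congr_onV ha ⟨_, hz⟩)
  have haE : ∀ z (hz : i.onE z ∈ K.edges), a.onE ⟨_, hz⟩ = z := fun z hz =>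
    hi.2 (congr_onE ha ⟨_, hz⟩)
  have hrV : Set.range (a ≫ j).onV = K'.verts := by
    refine Set.Subset.antisymm ?_ fun y hy => ?_
    · rintro _ ⟨x, rfl⟩
      refine (hV _).1 ?_
      rw [show i.onV _ = _ from congr_onV ha x]
      exact x.2
    · have hy' : j.onV (b.onV ⟨y, hy⟩) = y := congr_onV hb ⟨y, hy⟩
      exact ⟨⟨_, (hV (b.onV ⟨y, hy⟩)).2 (by rwa [hy'])⟩, (congrArg j.onV (haV _ _)).trans hy'⟩
  have hrE : Set.range (a ≫ j).onE = K'.edges := by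
    refine Set.Subset.antisymm ?_ fun y hy => ?_
    · rintro _ ⟨x, rfl⟩
      refine (hE _).1 ?_
      rw [show i.onE _ = _ from congr_onE ha x]
      exact x.2
    · have hy' : j.onE (b.onE ⟨y, hy⟩) = y := congr_onE hb ⟨y, hy⟩
      exact ⟨⟨_, (hE (b.onE ⟨y, hy⟩)).2 (by rwa [hy'])⟩, (congrArg j.onE (haE _ _)).trans hy'⟩
  obtain ⟨φ, hφ⟩ := hm.exists_iso K' hrV hrE
  refine ⟨φ.symm, hj.cancel ?_⟩
  rw [Category.assoc, hb, ← hφ, φ.symm_hom, φ.inv_hom_id_assoc]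

theorem IsBoundarySpan.boundary {S : RuleSpan.{u} T} (h : IsBoundarySpan S.i₁ S.i₂) :
    ∃ (φI : S.L.inB.graph ≅ S.R.inB.graph) (φO : S.L.outB.graph ≅ S.R.outB.graph)
      (φL : S.L.boundB.graph ≅ S.I) (φR : S.R.boundB.graph ≅ S.I),
      (S.L.inToBound ≫ φL.hom) ≫ S.i₁ = S.L.inB.incl ∧
      (S.L.outToBound ≫ φL.hom) ≫ S.i₁ = S.L.outB.incl ∧
      (S.R.inToBound ≫ φR.hom) ≫ S.i₂ = S.R.inB.incl ∧
      (S.R.outToBound ≫ φR.hom) ≫ S.i₂ = S.R.outB.incl ∧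
      φI.hom ≫ (S.R.inToBound ≫ φR.hom) = S.L.inToBound ≫ φL.hom ∧
      φO.hom ≫ (S.R.outToBound ≫ φR.hom) = S.L.outToBound ≫ φL.hom := by
  obtain ⟨φL, hφL⟩ := h.left.mono.exists_iso _ h.left.rangeV h.left.rangeE
  obtain ⟨φR, hφR⟩ := h.right.mono.exists_iso _ h.right.rangeV h.right.rangeE
  have h₁ : (S.L.inToBound ≫ φL.hom) ≫ S.i₁ = S.L.inB.incl := by rw [Category.assoc, hφL]; rfl
  have h₂ : (S.L.outToBound ≫ φL.hom) ≫ S.i₁ = S.L.outB.incl := by rw [Category.assoc, hφL]; rfl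
  have h₃ : (S.R.inToBound ≫ φR.hom) ≫ S.i₂ = S.R.inB.incl := by rw [Category.assoc, hφR]; rfl
  have h₄ : (S.R.outToBound ≫ φR.hom) ≫ S.i₂ = S.R.outB.incl := by rw [Category.assoc, hφR]; rfl
  have hin : ∀ z, S.i₁.onV z ∈ S.L.inB.verts ↔ S.i₂.onV z ∈ S.R.inB.verts := fun z =>
    or_congr (by rw [isBang_map, isBang_map]) (h.input z)
  have hout : ∀ z, S.i₁.onV z ∈ S.L.outB.verts ↔ S.i₂.onV z ∈ S.R.outB.verts := fun z =>
    or_congr (by rw [isBang_map, isBang_map]) (h.output z)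
  obtain ⟨φI, h₅⟩ := exists_iso_over h.left.mono h.right.mono _ _ h₁ h₃ hin
    (fun e => by
      refine and_congr ?_ ?_
      · rw [S.i₁.src_onE, S.i₂.src_onE]; exact hin _
      · rw [S.i₁.tgt_onE, S.i₂.tgt_onE]; exact hin _)
  obtain ⟨φO, h₆⟩ := exists_iso_over h.left.mono h.right.mono _ _ h₂ h₄ hout
    (fun e => by
      refine and_congr ?_ ?_
      · rw [S.i₁.src_onE, S.i₂.src_onE]; exact hout _
      · rw [S.i₁.tgt_onE, S.i₂.tgt_onE]; exact hout _)
  exact ⟨φI, φO, φL, φR, h₁, h₂, h₃, h₄, h₅, h₆⟩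

theorem IsBoundaryIncl.reflectsBox {I A : TypedGraph.{u} T} {i : I ⟶ A} (h : IsBoundaryIncl i) :
    ReflectsBox i := by
  intro e hb ht
  rw [h.rangeV] at ht
  rw [h.rangeE]
  exact ⟨hb, ht⟩

theorem IsBoundaryIncl.baseChange {I A I' A' : TypedGraph.{u} T} {i : I ⟶ A} {i' : I' ⟶ A'}
    {p : I' ⟶ I} {q : A' ⟶ A} (h : IsBoundaryIncl i) (b : IsBaseChange i' i p q)
    (hq : LiftsWireEdges q) : IsBoundaryIncl i' where
  mono := b.mono
  rangeV := Set.ext fun x => by rw [b.mem_rangeV, h.rangeV, hq.mem_boundB_verts_iff]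
  rangeE := Set.ext fun x => by rw [b.mem_rangeE, h.rangeE, hq.mem_boundB_edges_iff]

theorem IsBoundarySpan.baseChange {I A B I' A' B' : TypedGraph.{u} T} {i : I ⟶ A} {j : I ⟶ B}
    {i' : I' ⟶ A'} {j' : I' ⟶ B'} {p : I' ⟶ I} {q : A' ⟶ A} {r : B' ⟶ B}
    (h : IsBoundarySpan i j) (bi : IsBaseChange i' i p q) (bj : IsBaseChange j' j p r)
    (hq : LiftsWireEdges q) (hr : LiftsWireEdges r) : IsBoundarySpan i' j' where
  left := h.left.baseChange bi hq
  right := h.right.baseChange bj hr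
  input z := by
    rw [← hq.isInput_iff, ← hr.isInput_iff, bi.commV, bj.commV]
    exact h.input _
  output z := by
    rw [← hq.isOutput_iff, ← hr.isOutput_iff, bi.commV, bj.commV]
    exact h.output _

/-! ### !-vertices in a rewrite -/

section Gluing

variable {I L D G : TypedGraph.{u} T} {i : I ⟶ L} {d : I ⟶ D} {m : L ⟶ G} {g : D ⟶ G}

/-- An edge of `G` from a !-vertex into the image of `D` comes from `D`: if it comes from `L`, then
its target comes from `I`, hence so does the edge. -/
theorem IsGluing.reflectsBox (h : IsGluing i d m g) (hi : ReflectsBox i) : ReflectsBox g := by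
  rintro e hb ⟨x, hx⟩
  rcases h.coverE e with ⟨y, rfl⟩ | he
  · rw [m.tgt_onE] at hx
    obtain ⟨z, hz, -⟩ := h.meetV _ _ hx.symm
    rw [m.src_onE, isBang_map] at hb
    obtain ⟨w, rfl⟩ := hi y hb ⟨z, hz⟩
    exact ⟨_, (h.commE w).symm⟩
  · exact he

theorem IsGluing.reflectsBox_corner (h : IsGluing i d m g) (hm : ReflectsBox m) :
    ReflectsBox d := by
  rintro e hb ⟨z, hz⟩
  obtain ⟨y, hy⟩ := hm (g.onE e) (by rwa [g.src_onE, isBang_map])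
    ⟨i.onV z, by rw [h.commV, hz, g.tgt_onE]⟩
  obtain ⟨w, -, hw⟩ := h.meetE y e hy
  exact ⟨w, hw⟩

/-- The !-vertices and the boundary of `G` come from `D`. -/
theorem IsGluing.boundB_verts_subset (h : IsGluing i d m g) (hi : IsBoundaryIncl i) :
    G.boundB.verts ⊆ Set.range g.onV := by
  intro x hx
  rcases h.coverV x with ⟨y, rfl⟩ | hx
  · obtain ⟨z, rfl⟩ : y ∈ Set.range i.onV := by
      rw [hi.rangeV]
      refine hx.imp (isBang_map m y).1 (Or.imp ?_ ?_)
      · refine fun hx => ⟨(isWire_map m y).1 hx.1, fun e he ht => ?_⟩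
        exact hx.2 (m.onE e) ((isCore_map m e).2 he) (by rw [m.tgt_onE, ht])
      · refine fun hx => ⟨(isWire_map m y).1 hx.1, fun e he ht => ?_⟩
        exact hx.2 (m.onE e) ((isCore_map m e).2 he) (by rw [m.src_onE, ht])
    exact ⟨_, (h.commV z).symm⟩
  · exact hx

theorem IsGluing.boundB_edges_subset (h : IsGluing i d m g) (hi : IsBoundaryIncl i) :
    G.boundB.edges ⊆ Set.range g.onE := fun e he =>
  h.reflectsBox hi.reflectsBox e he.1 (h.boundB_verts_subset hi he.2)

end Gluing

/-! ### !-box operations on rewrites -/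

namespace DPO

section Rewrite

variable {S : RuleSpan.{u} T} {G D H : TypedGraph.{u} T} {P : DPO S G D H}

namespace IsRewrite

theorem gluing_left (hP : P.IsRewrite) : IsGluing S.i₁ P.d P.m P.g :=
  IsGluing.of_isPushout hP.left hP.mono_g

theorem gluing_right (hP : P.IsRewrite) : IsGluing S.i₂ P.d P.r P.h :=
  IsGluing.of_isPushout hP.right hP.mono_h

theorem reflectsBox_i₁ (hP : P.IsRewrite) : ReflectsBox S.i₁ :=
  hP.rule.isBoundarySpan.left.reflectsBox

theorem reflectsBox_i₂ (hP : P.IsRewrite) : ReflectsBox S.i₂ :=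
  hP.rule.isBoundarySpan.right.reflectsBox

theorem reflectsBox_g (hP : P.IsRewrite) : ReflectsBox P.g :=
  hP.gluing_left.reflectsBox hP.reflectsBox_i₁

theorem reflectsBox_h (hP : P.IsRewrite) : ReflectsBox P.h :=
  hP.gluing_right.reflectsBox hP.reflectsBox_i₂

theorem reflectsBox_d (hP : P.IsRewrite) (hm : ReflectsBox P.m) : ReflectsBox P.d :=
  hP.gluing_left.reflectsBox_corner hm

theorem reflectsBox_r (hP : P.IsRewrite) (hm : ReflectsBox P.m) : ReflectsBox P.r :=
  hP.gluing_right.flip.reflectsBox (hP.reflectsBox_d hm)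

theorem existsUnique_of_isBang (hP : P.IsRewrite) {b : G.V} (hb : G.IsBang b) :
    ∃! bD : D.V, P.g.onV bD = b := by
  obtain ⟨bD, h⟩ := hP.gluing_left.boundB_verts_subset hP.rule.isBoundarySpan.left (Or.inl hb)
  exact ⟨bD, h, fun y hy => hP.mono_g.1 (hy.trans h.symm)⟩

theorem existsUnique_of_mem_range (hP : P.IsRewrite) {b : G.V} (hb : G.IsBang b)
    (hr : b ∈ Set.range P.m.onV) : ∃! bI : S.I.V, P.m.onV (S.i₁.onV bI) = b := by
  obtain ⟨y, rfl⟩ := hr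
  have hi := hP.rule.isBoundarySpan.left
  obtain ⟨z, rfl⟩ : y ∈ Set.range S.i₁.onV := by
    rw [hi.rangeV]
    exact Or.inl ((isBang_map P.m y).1 hb)
  exact ⟨z, rfl, fun y hy => hi.mono.1 (hP.mono_m.1 hy)⟩

/-- A diagram that is a base change of a rewrite, along maps that lift the edges at wire-vertices on
the two sides of the rule, is a rewrite. -/
theorem baseChange (hP : P.IsRewrite) {S' : RuleSpan.{u} T} {G' D' H' : TypedGraph.{u} T}
    {P' : DPO S' G' D' H'} {pL : S'.L ⟶ S.L} {pI : S'.I ⟶ S.I} {pR : S'.R ⟶ S.R}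
    {pG : G' ⟶ G} {pD : D' ⟶ D} {pH : H' ⟶ H}
    (b₁ : IsBaseChange S'.i₁ S.i₁ pI pL) (b₂ : IsBaseChange S'.i₂ S.i₂ pI pR)
    (bm : IsBaseChange P'.m P.m pL pG) (bd : IsBaseChange P'.d P.d pI pD)
    (br : IsBaseChange P'.r P.r pR pH) (bg : IsBaseChange P'.g P.g pD pG)
    (bh : IsBaseChange P'.h P.h pD pH)
    (comm₁ : S'.i₁ ≫ P'.m = P'.d ≫ P'.g) (comm₂ : S'.i₂ ≫ P'.r = P'.d ≫ P'.h)
    (hpL : LiftsWireEdges pL) (hpR : LiftsWireEdges pR)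
    (hL : S'.L.IsBangGraph) (hI : S'.I.IsBangGraph) (hR : S'.R.IsBangGraph)
    (hG : G'.IsBangGraph) (hD : D'.IsBangGraph) (hH : H'.IsBangGraph) : P'.IsRewrite where
  rule :=
    { bang_L := hL
      bang_I := hI
      bang_R := hR
      noIsolated_L := hpL.noIsolatedWires hP.rule.noIsolated_L
      noIsolated_R := hpR.noIsolatedWires hP.rule.noIsolated_R
      boundary := (hP.rule.isBoundarySpan.baseChange b₁ b₂ hpL hpR).boundary }
  bang_G := hG
  bang_D := hD
  bang_H := hH
  mono_m := bm.mono
  mono_d := bd.mono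
  mono_r := br.mono
  mono_g := bg.mono
  mono_h := bh.mono
  left := (hP.gluing_left.baseChange hP.rule.isBoundarySpan.left.mono b₁ bm bg comm₁).isPushout
    bm.mono bg.mono
  right := (hP.gluing_right.baseChange hP.rule.isBoundarySpan.right.mono b₂ br bh
    comm₂).isPushout br.mono bh.mono

/-- A !-box operation at a !-vertex outside the image of the matching. -/
theorem exists_isOpOutside (hP : P.IsRewrite) (hm : IsMatching P.m) (op : BoxOp) {b : G.V}
    {bD : D.V} {bH : H.V} (hb : G.IsBang b) (hg : P.g.onV bD = b) (hh : P.h.onV bD = bH)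
    (hn : b ∉ Set.range P.m.onV) :
    ∃ P' : DPO S (op.obj G b) (op.obj D bD) (op.obj H bH),
      P.IsOpOutside op b bD bH P' ∧ P'.IsRewrite ∧ IsMatching P'.m := by
  subst hh hg
  have hbD : D.IsBang bD := (isBang_map P.g bD).1 hb
  have hbH : H.IsBang (P.h.onV bD) := (isBang_map P.h bD).2 hbD
  have hnD : bD ∉ Set.range P.d.onV := by
    rintro ⟨z, rfl⟩
    exact hn ⟨_, hP.gluing_left.commV z⟩
  have hnH : P.h.onV bD ∉ Set.range P.r.onV := by
    rintro ⟨y, hy⟩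
    obtain ⟨z, -, hz⟩ := hP.gluing_right.meetV y bD hy
    exact hnD ⟨z, hz⟩
  obtain ⟨m', hm'⟩ := exists_isOpMapOutside hm.reflects hb hn op
  obtain ⟨d', hd'⟩ := exists_isOpMapOutside (hP.reflectsBox_d hm.reflects) hbD hnD op
  obtain ⟨r', hr'⟩ := exists_isOpMapOutside (hP.reflectsBox_r hm.reflects) hbH hnH op
  obtain ⟨g', hg'⟩ := exists_isOpMap hP.mono_g hP.reflectsBox_g hbD rfl op
  obtain ⟨h', hh'⟩ := exists_isOpMap hP.mono_h hP.reflectsBox_h hbD rfl op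
  have bm := hm'.isBaseChange hP.mono_m
  have comm₁ : S.i₁ ≫ m' = d' ≫ g' := by
    have h₁ := hm'.comp_left S.i₁
    have h₂ := h₁.notMem_range
    rw [hP.left.w] at h₁ h₂
    exact h₁.unique (hd'.comp_right hg' h₂)
  have comm₂ : S.i₂ ≫ r' = d' ≫ h' := by
    have h₁ := hr'.comp_left S.i₂
    have h₂ := h₁.notMem_range
    rw [hP.right.w] at h₁ h₂
    exact h₁.unique (hd'.comp_right hh' h₂)
  have hS := hP.rule.isBoundarySpan
  refine ⟨⟨m', d', r', g', h'⟩, ⟨hm', hd', hr', hg', hh'⟩, ?_,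
    bm.isMatching hm hm.bang_L (isBangGraph_op hP.bang_G hb op)⟩
  exact hP.baseChange (isBaseChange_id hS.left.mono) (isBaseChange_id hS.right.mono) bm
    (hd'.isBaseChange hP.mono_d) (hr'.isBaseChange hP.mono_r) (hg'.isBaseChange hP.mono_g)
    (hh'.isBaseChange hP.mono_h) comm₁ comm₂ (liftsWireEdges_id _) (liftsWireEdges_id _)
    hP.rule.bang_L hP.rule.bang_I hP.rule.bang_R (isBangGraph_op hP.bang_G hb op)
    (isBangGraph_op hP.bang_D hbD op) (isBangGraph_op hP.bang_H hbH op)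

/-- A !-box operation at a !-vertex in the image of the matching. -/
theorem exists_isOpInside (hP : P.IsRewrite) (hm : IsMatching P.m) (op : BoxOp) {b : G.V}
    {bD : D.V} {bH : H.V} {bI : S.I.V} (hb : G.IsBang b) (hg : P.g.onV bD = b)
    (hh : P.h.onV bD = bH) (hI : P.m.onV (S.i₁.onV bI) = b) :
    ∃ (j₁ : op.obj S.I bI ⟶ op.obj S.L (S.i₁.onV bI))
      (j₂ : op.obj S.I bI ⟶ op.obj S.R (S.i₂.onV bI))
      (P' : DPO ⟨op.obj S.L (S.i₁.onV bI), op.obj S.I bI, op.obj S.R (S.i₂.onV bI), j₁, j₂⟩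
        (op.obj G b) (op.obj D bD) (op.obj H bH)),
      P.IsOpInside op (S.i₁.onV bI) bI (S.i₂.onV bI) b bD bH j₁ j₂ P' ∧
        P'.IsRewrite ∧ IsMatching P'.m := by
  have hdI : P.d.onV bI = bD := by
    apply hP.mono_g.1
    rw [← hP.gluing_left.commV, hI, hg]
  have hrI : P.r.onV (S.i₂.onV bI) = bH := by rw [hP.gluing_right.commV, hdI, hh]
  have hbD : D.IsBang bD := (isBang_map P.g bD).1 (hg ▸ hb)
  have hbH : H.IsBang bH := hh ▸ (isBang_map P.h bD).2 hbD
  have hbI : S.I.IsBang bI := (isBang_map P.d bI).1 (hdI ▸ hbD)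
  have hbL := (isBang_map S.i₁ bI).2 hbI
  have hbR := (isBang_map S.i₂ bI).2 hbI
  have hS := hP.rule.isBoundarySpan
  obtain ⟨j₁, h₁⟩ := exists_isOpMap hS.left.mono hP.reflectsBox_i₁ hbI rfl op
  obtain ⟨j₂, h₂⟩ := exists_isOpMap hS.right.mono hP.reflectsBox_i₂ hbI rfl op
  obtain ⟨m', hm'⟩ := exists_isOpMap hP.mono_m hm.reflects hbL hI op
  obtain ⟨d', hd'⟩ := exists_isOpMap hP.mono_d (hP.reflectsBox_d hm.reflects) hbI hdI op
  obtain ⟨r', hr'⟩ := exists_isOpMap hP.mono_r (hP.reflectsBox_r hm.reflects) hbR hrI op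
  obtain ⟨g', hg'⟩ := exists_isOpMap hP.mono_g hP.reflectsBox_g hbD hg op
  obtain ⟨h', hh'⟩ := exists_isOpMap hP.mono_h hP.reflectsBox_h hbD hh op
  have bm := hm'.isBaseChange hP.mono_m
  have comm₁ : j₁ ≫ m' = d' ≫ g' := by
    have h := h₁.comp hm'
    rw [hP.left.w] at h
    exact h.unique (hd'.comp hg')
  have comm₂ : j₂ ≫ r' = d' ≫ h' := by
    have h := h₂.comp hr'
    rw [hP.right.w] at h
    exact h.unique (hd'.comp hh')
  refine ⟨j₁, j₂, ⟨m', d', r', g', h'⟩, ⟨h₁, h₂, hm', hd', hr', hg', hh'⟩, ?_,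
    bm.isMatching hm (isBangGraph_op hm.bang_L hbL op) (isBangGraph_op hP.bang_G hb op)⟩
  exact hP.baseChange (h₁.isBaseChange hS.left.mono) (h₂.isBaseChange hS.right.mono) bm
    (hd'.isBaseChange hP.mono_d) (hr'.isBaseChange hP.mono_r) (hg'.isBaseChange hP.mono_g)
    (hh'.isBaseChange hP.mono_h) comm₁ comm₂ (liftsWireEdges_proj hP.rule.bang_L hbL op)
    (liftsWireEdges_proj hP.rule.bang_R hbR op) (isBangGraph_op hP.rule.bang_L hbL op)
    (isBangGraph_op hP.rule.bang_I hbI op) (isBangGraph_op hP.rule.bang_R hbR op)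
    (isBangGraph_op hP.bang_G hb op) (isBangGraph_op hP.bang_D hbD op)
    (isBangGraph_op hP.bang_H hbH op)

end IsRewrite

end Rewrite

end DPO

/-! ### The associated span -/

/-- Inputs that come from `D` survive a rewrite: if the image in `R` of a vertex of `I` has an
incoming edge, then it is not an input of `R`, hence not an input of `L` either, so that its image
in `G` has an incoming edge. -/
theorem IsBoundarySpan.isInput_of_gluing {I L R D G H : TypedGraph.{u} T} {i₁ : I ⟶ L}
    {i₂ : I ⟶ R} {d : I ⟶ D} {m : L ⟶ G} {r : R ⟶ H} {g : D ⟶ G} {h : D ⟶ H}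
    (hS : IsBoundarySpan i₁ i₂) (hl : IsGluing i₁ d m g) (hr : IsGluing i₂ d r h)
    (hh : IsMono h) {w : D.V} (hw : G.IsInput (g.onV w)) : H.IsInput (h.onV w) := by
  have hwire := (isWire_map g w).1 hw.1
  refine ⟨(isWire_map h w).2 hwire, fun e he ht => ?_⟩
  rcases hr.coverE e with ⟨y, rfl⟩ | ⟨e, rfl⟩
  · rw [r.tgt_onE] at ht
    obtain ⟨z, hz, rfl⟩ := hr.meetV _ _ ht
    have hzI := (isWire_map d z).1 hwire
    have hin : ¬ L.IsInput (i₁.onV z) := by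
      rw [hS.input]
      exact fun h => h.2 y ((isCore_map r y).1 he) hz.symm
    refine hin ⟨(isWire_map i₁ z).2 hzI, fun e' he' ht' => ?_⟩
    exact hw.2 (m.onE e') ((isCore_map m e').2 he') (by rw [m.tgt_onE, ht', hl.commV])
  · rw [h.tgt_onE] at ht
    refine hw.2 (g.onE e) ((isCore_map g e).2 ((isCore_map h e).1 he)) ?_
    rw [g.tgt_onE, hh.1 ht]

theorem IsBoundarySpan.isOutput_of_gluing {I L R D G H : TypedGraph.{u} T} {i₁ : I ⟶ L}
    {i₂ : I ⟶ R} {d : I ⟶ D} {m : L ⟶ G} {r : R ⟶ H} {g : D ⟶ G} {h : D ⟶ H}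
    (hS : IsBoundarySpan i₁ i₂) (hl : IsGluing i₁ d m g) (hr : IsGluing i₂ d r h)
    (hh : IsMono h) {w : D.V} (hw : G.IsOutput (g.onV w)) : H.IsOutput (h.onV w) := by
  have hwire := (isWire_map g w).1 hw.1
  refine ⟨(isWire_map h w).2 hwire, fun e he ht => ?_⟩
  rcases hr.coverE e with ⟨y, rfl⟩ | ⟨e, rfl⟩
  · rw [r.src_onE] at ht
    obtain ⟨z, hz, rfl⟩ := hr.meetV _ _ ht
    have hzI := (isWire_map d z).1 hwire
    have hout : ¬ L.IsOutput (i₁.onV z) := by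
      rw [hS.output]
      exact fun h => h.2 y ((isCore_map r y).1 he) hz.symm
    refine hout ⟨(isWire_map i₁ z).2 hzI, fun e' he' ht' => ?_⟩
    exact hw.2 (m.onE e') ((isCore_map m e').2 he') (by rw [m.src_onE, ht', hl.commV])
  · rw [h.src_onE] at ht
    refine hw.2 (g.onE e) ((isCore_map g e).2 ((isCore_map h e).1 he)) ?_
    rw [g.src_onE, hh.1 ht]

theorem IsGluing.noIsolatedWires {I L R D G H : TypedGraph.{u} T} {i₁ : I ⟶ L} {i₂ : I ⟶ R}
    {d : I ⟶ D} {m : L ⟶ G} {r : R ⟶ H} {g : D ⟶ G} {h : D ⟶ H} (hl : IsGluing i₁ d m g)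
    (hr : IsGluing i₂ d r h) (hg : IsMono g) (hG : G.NoIsolatedWires)
    (hR : R.NoIsolatedWires) : H.NoIsolatedWires := by
  intro x hx
  by_cases hxr : x ∈ Set.range r.onV
  · obtain ⟨y, rfl⟩ := hxr
    obtain ⟨e, he, hi⟩ := hR y ((isWire_map r y).1 hx)
    exact ⟨r.onE e, (isCore_map r e).2 he, incident_map hi⟩
  · obtain ⟨w, rfl⟩ := (hr.coverV x).resolve_left hxr
    obtain ⟨e, he, hi⟩ := hG (g.onV w) ((isWire_map g w).2 ((isWire_map h w).1 hx))
    rcases hl.coverE e with ⟨y, rfl⟩ | ⟨e, rfl⟩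
    · -- An edge of `L` at the image of `w` would put `w` into the image of `I`.
      exfalso
      obtain ⟨v, hv⟩ : ∃ v, m.onV v = g.onV w := by
        rcases hi with hi | hi
        · exact ⟨_, (m.src_onE y).symm.trans hi⟩
        · exact ⟨_, (m.tgt_onE y).symm.trans hi⟩
      obtain ⟨z, -, rfl⟩ := hl.meetV _ _ hv
      exact hxr ⟨_, hr.commV z⟩
    · exact ⟨h.onE e, (isCore_map h e).2 ((isCore_map g e).1 he),
        incident_map (hg.incident_iff.1 hi)⟩

/-- The boundary graph of a !-graph is a !-graph; it has no node-vertices. -/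
theorem IsBoundaryIncl.isBangGraph {I A : TypedGraph.{u} T} {i : I ⟶ A} (h : IsBoundaryIncl i)
    (hA : A.IsBangGraph) : I.IsBangGraph := by
  refine h.mono.isBangGraph hA (fun e hb _ ht => h.reflectsBox e hb ht) fun x hx => ?_
  have hx' : i.onV x ∈ A.boundB.verts := h.rangeV ▸ ⟨x, rfl⟩
  rcases hx' with hb | hw | hw
  · exact (hx.not_isBang ((isBang_map i x).1 hb)).elim
  · exact (((isWire_map i x).1 hw.1).not_isNode hx).elim
  · exact (((isWire_map i x).1 hw.1).not_isNode hx).elim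

namespace DPO

variable {S : RuleSpan.{u} T} {G D H : TypedGraph.{u} T} {P : DPO S G D H}

theorem IsRewrite.isBoundarySpan_associated (hP : P.IsRewrite) :
    IsBoundarySpan P.associated.i₁ P.associated.i₂ := by
  have hS := hP.rule.isBoundarySpan
  have hl := hP.gluing_left
  have hr := hP.gluing_right
  have hin : ∀ w, G.IsInput (P.g.onV w) ↔ H.IsInput (P.h.onV w) := fun w =>
    ⟨hS.isInput_of_gluing hl hr hP.mono_h, hS.symm.isInput_of_gluing hr hl hP.mono_g⟩
  have hout : ∀ w, G.IsOutput (P.g.onV w) ↔ H.IsOutput (P.h.onV w) := fun w =>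
    ⟨hS.isOutput_of_gluing hl hr hP.mono_h, hS.symm.isOutput_of_gluing hr hl hP.mono_g⟩
  have hV : ∀ w, P.g.onV w ∈ G.boundB.verts ↔ P.h.onV w ∈ H.boundB.verts := fun w =>
    or_congr (by rw [isBang_map, isBang_map]) (or_congr (hin w) (hout w))
  have hE : ∀ e, P.g.onE e ∈ G.boundB.edges ↔ P.h.onE e ∈ H.boundB.edges := fun e => by
    change _ ∧ G.tgt _ ∈ G.boundB.verts ↔ _ ∧ H.tgt _ ∈ H.boundB.verts
    rw [P.g.src_onE, P.h.src_onE, P.g.tgt_onE, P.h.tgt_onE, isBang_map, isBang_map, hV]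
  let K := G.boundB.comap P.g
  refine ⟨⟨K.isMono_incl.comp hP.mono_g, ?_, ?_⟩, ⟨K.isMono_incl.comp hP.mono_h, ?_, ?_⟩,
    fun z => hin _, fun z => hout _⟩
  · refine Set.Subset.antisymm (by rintro _ ⟨x, rfl⟩; exact x.2) fun x hx => ?_
    obtain ⟨w, rfl⟩ := hl.boundB_verts_subset hS.left hx
    exact ⟨⟨w, hx⟩, rfl⟩
  · refine Set.Subset.antisymm (by rintro _ ⟨x, rfl⟩; exact x.2) fun x hx => ?_
    obtain ⟨w, rfl⟩ := hl.boundB_edges_subset hS.left hx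
    exact ⟨⟨w, hx⟩, rfl⟩
  · refine Set.Subset.antisymm (by rintro _ ⟨x, rfl⟩; exact (hV _).1 x.2) fun x hx => ?_
    obtain ⟨w, rfl⟩ := hr.boundB_verts_subset hS.right hx
    exact ⟨⟨w, (hV w).2 hx⟩, rfl⟩
  · refine Set.Subset.antisymm (by rintro _ ⟨x, rfl⟩; exact (hE _).1 x.2) fun x hx => ?_
    obtain ⟨w, rfl⟩ := hr.boundB_edges_subset hS.right hx
    exact ⟨⟨w, (hE w).2 hx⟩, rfl⟩

theorem IsRewrite.isRule_associated (hP : P.IsRewrite) (hG : G.NoIsolatedWires) :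
    P.associated.IsRule where
  bang_L := hP.bang_G
  bang_I := hP.isBoundarySpan_associated.left.isBangGraph hP.bang_G
  bang_R := hP.bang_H
  noIsolated_L := hG
  noIsolated_R := hP.gluing_left.noIsolatedWires hP.gluing_right hP.mono_g hG
    hP.rule.noIsolated_R
  boundary := hP.isBoundarySpan_associated.boundary

/-! ### Instances of the associated span -/

/-- The morphism `k` identifies the span with legs `a` and `c` with the associated span of `P`, over
the identities of `G` and `H`. -/
structure IsAssociatedVia {G D H : TypedGraph.{u} T} (P : DPO S G D H) {J : TypedGraph.{u} T}
    (a : J ⟶ G) (c : J ⟶ H) (k : J ⟶ D) : Prop where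
  mono : IsMono k
  comm₁ : k ≫ P.g = a
  comm₂ : k ≫ P.h = c
  rangeV : Set.range k.onV = (G.boundB.comap P.g).verts
  rangeE : Set.range k.onE = (G.boundB.comap P.g).edges

theorem isAssociatedVia_incl (P : DPO S G D H) :
    P.IsAssociatedVia P.associated.i₁ P.associated.i₂ (G.boundB.comap P.g).incl :=
  ⟨TypedGraph.Subgraph.isMono_incl _, rfl, rfl, Subtype.range_val, Subtype.range_val⟩

theorem IsAssociatedVia.exists_iso {J : TypedGraph.{u} T} {a : J ⟶ G} {c : J ⟶ H} {k : J ⟶ D}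
    (h : P.IsAssociatedVia a c k) : ∃ φ : P.associated.I ≅ J,
      φ.hom ≫ a = P.associated.i₁ ∧ φ.hom ≫ c = P.associated.i₂ := by
  obtain ⟨φ, hφ⟩ := h.mono.exists_iso _ h.rangeV h.rangeE
  refine ⟨φ, ?_, ?_⟩
  · rw [← h.comm₁]
    exact congrArg (· ≫ P.g) hφ
  · rw [← h.comm₂]
    exact congrArg (· ≫ P.h) hφ

theorem IsAssociatedVia.reflectsBox {J : TypedGraph.{u} T} {a : J ⟶ G} {c : J ⟶ H} {k : J ⟶ D}
    (h : P.IsAssociatedVia a c k) : ReflectsBox k := by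
  intro e hb ht
  rw [h.rangeV] at ht
  rw [h.rangeE]
  refine ⟨?_, ?_⟩
  · rwa [P.g.src_onE, isBang_map]
  · rw [P.g.tgt_onE]
    exact ht

/-- The associated span of `OP(P)` is `OP` of the associated span of `P`. -/
theorem IsAssociatedVia.op {S' : RuleSpan.{u} T} {J : TypedGraph.{u} T} {a : J ⟶ G} {c : J ⟶ H}
    {k : J ⟶ D} (h : P.IsAssociatedVia a c k) (hP : P.IsRewrite) {op : BoxOp} {x : J.V}
    {b : G.V} {bD : D.V} {bH : H.V} (hx : J.IsBang x) (hk : k.onV x = bD)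
    {a' : op.obj J x ⟶ op.obj G b} {c' : op.obj J x ⟶ op.obj H bH} (ha : IsOpMap a x b op a')
    (hc : IsOpMap c x bH op c') {P' : DPO S' (op.obj G b) (op.obj D bD) (op.obj H bH)}
    (hg : IsOpMap P.g bD b op P'.g) (hh : IsOpMap P.h bD bH op P'.h) :
    ∃ k' : op.obj J x ⟶ op.obj D bD, P'.IsAssociatedVia a' c' k' := by
  obtain ⟨k', hk'⟩ := exists_isOpMap h.mono h.reflectsBox hx hk op
  have bk := hk'.isBaseChange h.mono
  have hb : G.IsBang b := by
    rw [← ha.onV_eq, isBang_map]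
    exact hx
  have hl := liftsWireEdges_proj hP.bang_G hb op
  refine ⟨k', bk.mono, ?_, ?_, Set.ext fun y => ?_, Set.ext fun y => ?_⟩
  · have H := hk'.comp hg
    rw [h.comm₁] at H
    exact H.unique ha
  · have H := hk'.comp hh
    rw [h.comm₂] at H
    exact H.unique hc
  · rw [bk.mem_rangeV, h.rangeV]
    change P.g.onV _ ∈ G.boundB.verts ↔ P'.g.onV _ ∈ (op.obj G b).boundB.verts
    rw [← hl.mem_boundB_verts_iff, (hg.isBaseChange hP.mono_g).commV]
  · rw [bk.mem_rangeE, h.rangeE]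
    change P.g.onE _ ∈ G.boundB.edges ↔ P'.g.onE _ ∈ (op.obj G b).boundB.edges
    rw [← hl.mem_boundB_edges_iff, (hg.isBaseChange hP.mono_g).commE]

/-- The span `S'` is, up to isomorphism over its two feet, the associated span of a rewrite by an
instance of `S` at a matching. -/
def IsRewriteOfInstance (S S' : RuleSpan.{u} T) : Prop :=
  ∃ (S₀ : RuleSpan.{u} T) (D' : TypedGraph.{u} T) (P' : DPO S₀ S'.L D' S'.R) (k : S'.I ⟶ D'),
    S.HasInstance S₀ ∧ P'.IsRewrite ∧ IsMatching P'.m ∧ P'.IsAssociatedVia S'.i₁ S'.i₂ k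

theorem IsRewriteOfInstance.op {S S' : RuleSpan.{u} T} (h : IsRewriteOfInstance S S')
    {op : BoxOp} {b : S'.I.V} (hb : S'.I.IsBang b)
    {j₁ : op.obj S'.I b ⟶ op.obj S'.L (S'.i₁.onV b)}
    {j₂ : op.obj S'.I b ⟶ op.obj S'.R (S'.i₂.onV b)} (h₁ : IsOpMap S'.i₁ b (S'.i₁.onV b) op j₁)
    (h₂ : IsOpMap S'.i₂ b (S'.i₂.onV b) op j₂) : IsRewriteOfInstance S
      ⟨op.obj S'.L (S'.i₁.onV b), op.obj S'.I b, op.obj S'.R (S'.i₂.onV b), j₁, j₂⟩ := by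
  obtain ⟨S₀, D', P, k, hS₀, hP, hm, hk⟩ := h
  have hbG : S'.L.IsBang (S'.i₁.onV b) := (isBang_map _ _).2 hb
  have hg : P.g.onV (k.onV b) = S'.i₁.onV b := congr_onV hk.comm₁ b
  have hh : P.h.onV (k.onV b) = S'.i₂.onV b := congr_onV hk.comm₂ b
  by_cases hr : S'.i₁.onV b ∈ Set.range P.m.onV
  · obtain ⟨bI, hI, -⟩ := hP.existsUnique_of_mem_range hbG hr
    obtain ⟨t₁, t₂, P', hop, hP', hm'⟩ := hP.exists_isOpInside hm op hbG hg hh hI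
    obtain ⟨k', hk'⟩ := hk.op hP hb rfl h₁ h₂ hop.g hop.h
    have hbI : S₀.I.IsBang bI := by
      rw [← isBang_map S₀.i₁, ← isBang_map P.m, hI]
      exact hbG
    exact ⟨_, _, P', k', hS₀.tail (.op S₀ op bI hbI t₁ t₂ hop.i₁ hop.i₂), hP', hm', hk'⟩
  · obtain ⟨P', hop, hP', hm'⟩ := hP.exists_isOpOutside hm op hbG hg hh hr
    obtain ⟨k', hk'⟩ := hk.op hP hb rfl h₁ h₂ hop.g hop.h
    exact ⟨_, _, P', k', hS₀, hP', hm', hk'⟩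

theorem IsRewriteOfInstance.iso {S S' S'' : RuleSpan.{u} T} (h : IsRewriteOfInstance S S')
    (a : S'.L ≅ S''.L) (c : S'.I ≅ S''.I) (e : S'.R ≅ S''.R)
    (h₁ : c.hom ≫ S''.i₁ = S'.i₁ ≫ a.hom) (h₂ : c.hom ≫ S''.i₂ = S'.i₂ ≫ e.hom) :
    IsRewriteOfInstance S S'' := by
  obtain ⟨S₀, D', P, k, hS₀, hP, hm, hk⟩ := h
  have hS := hP.rule.isBoundarySpan
  have hG := isBangGraph_of_iso a hP.bang_G
  have hH := isBangGraph_of_iso e hP.bang_H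
  have bm := isBaseChange_iso hP.mono_m a
  have bg := isBaseChange_iso hP.mono_g a
  have hl := liftsWireEdges_iso a.symm
  refine ⟨S₀, D', ⟨P.m ≫ a.hom, P.d, P.r ≫ e.hom, P.g ≫ a.hom, P.h ≫ e.hom⟩, c.inv ≫ k, hS₀,
    ?_, bm.isMatching hm hm.bang_L hG, ?_⟩
  · exact hP.baseChange (isBaseChange_id hS.left.mono) (isBaseChange_id hS.right.mono) bm
      (isBaseChange_id hP.mono_d) (isBaseChange_iso hP.mono_r e) bg
      (isBaseChange_iso hP.mono_h e)
      (congrArg (· ≫ a.hom) hP.left.w) (congrArg (· ≫ e.hom) hP.right.w)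
      (liftsWireEdges_id _) (liftsWireEdges_id _) hP.rule.bang_L hP.rule.bang_I hP.rule.bang_R
      hG hP.bang_D hH
  · refine ⟨(isMono_iso c.symm).comp hk.mono, ?_, ?_, ?_, ?_⟩
    · rw [Category.assoc, ← Category.assoc k, hk.comm₁, ← h₁, c.inv_hom_id_assoc]
    · rw [Category.assoc, ← Category.assoc k, hk.comm₂, ← h₂, c.inv_hom_id_assoc]
    · refine ((iso_surjective_onV c.symm).range_comp k.onV).trans (hk.rangeV.trans ?_)
      ext w
      change P.g.onV w ∈ S'.L.boundB.verts ↔ a.hom.onV (P.g.onV w) ∈ S''.L.boundB.verts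
      rw [← hl.mem_boundB_verts_iff]
      exact iff_of_eq (congrArg (· ∈ S'.L.boundB.verts) (bg.commV w).symm)
    · refine ((iso_surjective_onE c.symm).range_comp k.onE).trans (hk.rangeE.trans ?_)
      ext w
      change P.g.onE w ∈ S'.L.boundB.edges ↔ a.hom.onE (P.g.onE w) ∈ S''.L.boundB.edges
      rw [← hl.mem_boundB_edges_iff]
      exact iff_of_eq (congrArg (· ∈ S'.L.boundB.edges) (bg.commE w).symm)

/-- Every instance of the associated span of a rewrite comes from a rewrite by an instance of the
rule: follow the chain of !-box operations, applying each one to the whole diagram. -/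
theorem IsRewrite.isRewriteOfInstance (hP : P.IsRewrite) (hm : IsMatching P.m)
    {S' : RuleSpan.{u} T} (h : P.associated.HasInstance S') : IsRewriteOfInstance S S' := by
  induction h with
  | refl => exact ⟨S, D, P, _, .refl, hP, hm, P.isAssociatedVia_incl⟩
  | tail _ hstep ih =>
    cases hstep with
    | op op b hb _ _ h₁ h₂ => exact ih.op hb h₁ h₂
    | iso _ a c e h₁ h₂ => exact ih.iso a c e h₁ h₂

theorem IsRewrite.exists_concrete (hP : P.IsRewrite) (hm : IsMatching P.m)
    {S' : RuleSpan.{u} T} (h : P.associated.HasInstance S') (hS' : S'.IsConcrete) :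
    ∃ S₀ : RuleSpan.{u} T, S.HasInstance S₀ ∧ S₀.IsConcrete ∧
      ∃ (D' : TypedGraph.{u} T) (P' : DPO S₀ S'.L D' S'.R),
        P'.IsRewrite ∧ IsMatching P'.m ∧ P.associated.HasInstance P'.associated ∧
        ∃ k : P'.associated.I ≅ S'.I,
          k.hom ≫ S'.i₁ = P'.associated.i₁ ∧ k.hom ≫ S'.i₂ = P'.associated.i₂ := by
  obtain ⟨S₀, D', P', k, hS₀, hP', hm', hk⟩ := hP.isRewriteOfInstance hm h
  obtain ⟨φ, h₁, h₂⟩ := hk.exists_iso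
  refine ⟨S₀, hS₀, ⟨fun x hx => ?_, fun x hx => ?_, fun x hx => ?_⟩, D', P', hP', hm', ?_,
    φ, h₁, h₂⟩
  · exact hS'.1 _ ((isBang_map P'.m x).2 hx)
  · exact hS'.1 _ ((isBang_map (S₀.i₁ ≫ P'.m) x).2 hx)
  · exact hS'.2.2 _ ((isBang_map P'.r x).2 hx)
  · refine h.tail (.iso S' P'.associated (Iso.refl _) φ.symm (Iso.refl _) ?_ ?_)
    · rw [← h₁]
      exact φ.inv_hom_id_assoc _
    · rw [← h₂]
      exact φ.inv_hom_id_assoc _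

end DPO

end BangGraph

theorem mainTheorem2 {T : Signature.{w}} {S : RuleSpan.{u} T} {G D H : TypedGraph.{u} T}
    (P : DPO S G D H) (hP : P.IsRewrite) (hm : IsMatching P.m) :
    (∀ b : G.V, G.IsBang b →
      (∃! bD : D.V, P.g.onV bD = b) ∧
      (b ∈ Set.range P.m.onV → ∃! bI : S.I.V, P.m.onV (S.i₁.onV bI) = b) ∧
      ∀ (op : BoxOp) (bD : D.V), P.g.onV bD = b →
        (b ∉ Set.range P.m.onV →
          ∃ P' : DPO S (op.obj G b) (op.obj D bD) (op.obj H (P.h.onV bD)),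
            P.IsOpOutside op b bD (P.h.onV bD) P' ∧ P'.IsRewrite ∧ IsMatching P'.m) ∧
        (∀ bI : S.I.V, P.m.onV (S.i₁.onV bI) = b →
          ∃ (j₁ : op.obj S.I bI ⟶ op.obj S.L (S.i₁.onV bI))
            (j₂ : op.obj S.I bI ⟶ op.obj S.R (S.i₂.onV bI))
            (P' : DPO ⟨op.obj S.L (S.i₁.onV bI), op.obj S.I bI, op.obj S.R (S.i₂.onV bI), j₁, j₂⟩
              (op.obj G b) (op.obj D bD) (op.obj H (P.h.onV bD))),
            P.IsOpInside op (S.i₁.onV bI) bI (S.i₂.onV bI) b bD (P.h.onV bD) j₁ j₂ P' ∧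
              P'.IsRewrite ∧ IsMatching P'.m)) ∧
    (G.NoIsolatedWires →
      P.associated.IsRule ∧
      ∀ S' : RuleSpan.{u} T, P.associated.HasInstance S' → S'.IsConcrete →
        ∃ S₀ : RuleSpan.{u} T, S.HasInstance S₀ ∧ S₀.IsConcrete ∧
          ∃ (D' : TypedGraph.{u} T) (P' : DPO S₀ S'.L D' S'.R),
            P'.IsRewrite ∧ IsMatching P'.m ∧ P.associated.HasInstance P'.associated ∧
            ∃ k : P'.associated.I ≅ S'.I,
              k.hom ≫ S'.i₁ = P'.associated.i₁ ∧ k.hom ≫ S'.i₂ = P'.associated.i₂) := by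
  refine ⟨fun b hb => ⟨hP.existsUnique_of_isBang hb, hP.existsUnique_of_mem_range hb,
    fun op bD hbD => ⟨hP.exists_isOpOutside hm op hb hbD rfl,
      fun bI hbI => hP.exists_isOpInside hm op hb hbD rfl hbI⟩⟩,
    fun hG => ⟨hP.isRule_associated hG, fun S' hS' hc => hP.exists_concrete hm hS' hc⟩⟩
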